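/- **Model.** Let $r_1<\dots<r_K$ be positive rates, $\mathcal M=\{1,\dots,M\}$ a set of modes, $\mathcal D=\mathcal M\times\{r_1,\dots,r_K\}$ the set of decisions, $D=|\mathcal D|$, and $r(d)$ the rate of $d\in\mathcal D$. When decision $d$ is taken for the $i$-th time the reward is $r(d)X_d(i)$, where, for each $d$, $X_d(1),X_d(2),\dots$ are i.i.d. Bernoulli variables with mean $\theta_d\in[0,1]$ (the outcomes of different decisions may be arbitrarily dependent). Put $\mu_d=r(d)\theta_d$. Let $G$ be an undirected simple graph on $\mathcal D$. Assume * (correlation, $\theta\in\mathcal T'$) $\theta_{(m,r_k)}\ge\theta_{(m,r_l)}$ for every mode $m$ and all $k<l$; * (graphical unimodality, $\theta\in\mathcal U_G$) there is a unique $d^\star$ maximizing $\mu_d$, and from every $d\in\mathcal D$ there is a path in $G$ to $d^\star$ along which $\mu$ strictly increases. Write $\mu^\star=\mu_{d^\star}$. Let $I(p,q)=p\log\frac pq+(1-p)\log\frac{1-p}{1-q}\in[0,\infty]$ be the Bernoulli Kullback–Leibler divergence, and $$c_G(\theta)=\sum_{d}\frac{\mu^\star-\mu_d}{I(\theta_d,\mu^\star/r(d))},$$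 the sum being over the neighbours $d$ of $d^\star$ in $G$ with $r(d)\ge\mu^\star$ (a term with infinite denominator is $0$). **G-ORS.** Fix a constant $c>0$ and an integer $p\ge2$ (for instance the maximum degree of $G$ when that is at least $2$). Let $t_d(n)$ be the number of slots before slot $n$ in which $d$ was selected, $\hat\mu_d(n)$ the empirical average reward of $d$ over those slots ($0$ if $t_d(n)=0$), the leader $L(n)\in\arg\max_d\hat\mu_d(n)$, and $l_d(n)$ the number of slots before $n$ in which $d$ was the leader. In the first $D$ slots every decision is selected once, in any order. In slot $n>D$, if $(l_{L(n)}(n)-1)/p\in\mathbb N=\{0,1,2,\dots\}$ the leader $L(n)$ is selected; otherwise one selects, among $L(n)$ and its neighbours in $G$, a decision with maximal index $$b_d(n)=\max\Big\{q\in[0,r(d)]:\ t_d(n)\,I\Big(\tfrac{\hat\mu_d(n)}{r(d)},\tfrac q{r(d)}\Big)\le\log l_{L(n)}(n)+c\log\log l_{L(n)}(n)\Big\}$$ (any of them in the slots in which the right-hand side is undefined or negative). All ties are broken arbitrarily, by any measurable rule. The regret after $T$ slots is $R(T)=\mu^\star T-\sum_{d}\mu_d\,\mathbb E[t_d]$,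 with $t_d$ the number of times $d$ is selected in the first $T$ slots. **Theorem.** Under these assumptions, G-ORS satisfies, for every $\epsilon>0$, $$R(T)\le(1+\epsilon)\,c_G(\theta)\log T+O(\log\log T)\qquad(T\to\infty),$$ and consequently $$\limsup_{T\to\infty}\frac{R(T)}{\log T}\le c_G(\theta).$$ -/

import Mathlib

open Filter MeasureTheory ProbabilityTheory Asymptotics
open scoped ENNReal

namespace GORS

noncomputable section

/-- Kullback-Leibler divergence between the Bernoulli laws of parameters `p` and `q` (both in
`[0,1]`), with values in `[0, ∞]` and the usual conventions: `0 log (0 / q) = 0`, and the divergence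
is infinite when `Bernoulli p` is not absolutely continuous with respect to `Bernoulli q`. -/
def klBernoulli (p q : ℝ) : ℝ≥0∞ :=
  open Classical in
  if (q = 0 ∧ p ≠ 0) ∨ (q = 1 ∧ p ≠ 1) then ⊤
  else ENNReal.ofReal (p * Real.log (p / q) + (1 - p) * Real.log ((1 - p) / (1 - q)))

/-! ### The model. Decisions are pairs `(m, k)`, with mode `m` and rate `r k`. -/

/-- Success probabilities in `[0,1]` that, for each mode, are nonincreasing in the rate. -/
def Correlated {M K : ℕ} (θ : Fin M × Fin K → ℝ) : Prop :=
  (∀ d, θ d ∈ Set.Icc (0 : ℝ) 1) ∧ ∀ m k l, k < l → θ (m, l) ≤ θ (m, k)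

section Bandit

variable {V : Type*}

/-- `dstar` is the unique decision of maximal expected reward `ρ d * θ d`. -/
def IsBest (ρ θ : V → ℝ) (dstar : V) : Prop :=
  ∀ d, d ≠ dstar → ρ d * θ d < ρ dstar * θ dstar

/-- Graphical unimodality: from every decision there is a path in `G` to the best decision along
which the expected reward strictly increases. -/
def GraphUnimodal (G : SimpleGraph V) (ρ θ : V → ℝ) : Prop :=
  (∀ d, θ d ∈ Set.Icc (0 : ℝ) 1) ∧
  ∃ dstar, IsBest ρ θ dstar ∧
    ∀ d, ∃ (len : ℕ) (w : ℕ → V), w 0 = d ∧ w len = dstar ∧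
      ∀ i < len, G.Adj (w i) (w (i + 1)) ∧ ρ (w i) * θ (w i) < ρ (w (i + 1)) * θ (w (i + 1))

/-- The constant `c_G(θ)`: the sum over the neighbours `d` of the best decision whose rate satisfies
`ρ dstar * θ dstar ≤ ρ d` of the gap divided by `I(θ d, ρ dstar * θ dstar / ρ d)`. A term whose
divergence is infinite (`ρ d = ρ dstar * θ dstar`) contributes `0`. -/
def cG [Fintype V] (G : SimpleGraph V) (ρ θ : V → ℝ) (dstar : V) : ℝ :=
  open Classical in
  ∑ d ∈ Finset.univ.filter (fun d => G.Adj dstar d ∧ ρ dstar * θ dstar ≤ ρ d),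
    (ρ dstar * θ dstar - ρ d * θ d) *
      ((klBernoulli (θ d) (ρ dstar * θ dstar / ρ d))⁻¹).toReal

/-! ### The algorithm. Slots and selections are numbered from `0`: slot `n` here is slot `n + 1` in
the usual numbering, and `x d i` is the outcome (`1` or `0`) of the `(i + 1)`-st selection of `d`. -/

/-- Number of slots before slot `n` at which the sequence `u` takes the value `d`: for `u` the
sequence of decisions this is `t_d`, for `u` the sequence of leaders it is `l_d`. -/
def countBefore [DecidableEq V] (u : ℕ → V) (d : V) (n : ℕ) : ℕ :=
  ((Finset.range n).filter (fun m => u m = d)).card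

/-- Empirical average reward of `d` over the slots before slot `n` (`0` if `d` was never selected). -/
def empMean [DecidableEq V] (ρ : V → ℝ) (x : V → ℕ → ℝ) (dec : ℕ → V) (d : V) (n : ℕ) : ℝ :=
  (∑ i ∈ Finset.range (countBefore dec d n), ρ d * x d i) / countBefore dec d n

/-- The index of a decision of rate `R` selected `t` times with empirical average reward `μ`, when
the present leader has been leader `l` times: the largest `q ∈ [0, R]` with
`t I(μ / R, q / R) ≤ log l + c log log l`. For `l ≤ 1` the right-hand side is read as `-∞`. If no `q`
qualifies (which does not depend on the decision) the index is `0` for every decision. -/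
def klIndex (c R μ : ℝ) (t l : ℕ) : ℝ :=
  sSup {q : ℝ | q ∈ Set.Icc 0 R ∧ 2 ≤ l ∧
    (((t : ℝ≥0∞) * klBernoulli (μ / R) (q / R) : ℝ≥0∞) : EReal) ≤
      ((Real.log l + c * Real.log (Real.log l) : ℝ) : EReal)}

/-- `dec` (decisions) and `lead` (leaders) form a trajectory of G-ORS on the outcomes `x`, with
exploration constant `c` and with the leader selected at every `p`-th slot of its leadership.
All ties, and the order of the initial selections, are arbitrary. -/
structure IsTrajectory [Fintype V] [DecidableEq V] (G : SimpleGraph V) (ρ : V → ℝ) (c : ℝ) (p : ℕ)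
    (x : V → ℕ → ℝ) (dec lead : ℕ → V) : Prop where
  /-- the leader has maximal empirical average reward -/
  leader : ∀ n d, empMean ρ x dec d n ≤ empMean ρ x dec (lead n) n
  /-- each decision is selected exactly once in the first `|V|` slots -/
  init : ∀ d, ∃! n, n < Fintype.card V ∧ dec n = d
  /-- if `(l - 1) / p ∈ ℕ`, with `l` the leadership count of the leader, the leader is selected -/
  exploit : ∀ n, Fintype.card V ≤ n →
    (∃ j : ℕ, countBefore lead (lead n) n = j * p + 1) → dec n = lead n
  /-- otherwise the selected decision is the leader or one of its neighbours ... -/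
  near : ∀ n, Fintype.card V ≤ n →
    (¬ ∃ j : ℕ, countBefore lead (lead n) n = j * p + 1) →
      dec n = lead n ∨ G.Adj (lead n) (dec n)
  /-- ... and has maximal index among these -/
  maxIndex : ∀ n, Fintype.card V ≤ n →
    (¬ ∃ j : ℕ, countBefore lead (lead n) n = j * p + 1) →
      ∀ d, (d = lead n ∨ G.Adj (lead n) d) →
        klIndex c (ρ d) (empMean ρ x dec d n) (countBefore dec d n)
            (countBefore lead (lead n) n) ≤
          klIndex c (ρ (dec n)) (empMean ρ x dec (dec n) n) (countBefore dec (dec n) n)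
            (countBefore lead (lead n) n)

/-- For each decision `d`, the outcomes `X d 0, X d 1, ...` are i.i.d. Bernoulli of mean `θ d`.
Nothing is assumed on the joint law of the outcomes of different decisions. -/
structure BernoulliOutcomes {Ω : Type*} [MeasurableSpace Ω] (P : Measure Ω) (θ : V → ℝ)
    (X : V → ℕ → Ω → ℝ) : Prop where
  measurable : ∀ d i, Measurable (X d i)
  binary : ∀ d i ω, X d i ω = 0 ∨ X d i ω = 1
  mean : ∀ d i, P {ω | X d i ω = 1} = ENNReal.ofReal (θ d)
  indep : ∀ d, iIndepFun (fun i => X d i) P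

/-- The regret after `T` slots of the random sequence of decisions `dec`, when `dstar` is the best
decision: `ρ dstar * θ dstar * T - ∑ d, ρ d * θ d * E[t_d(T)]`. -/
def regret [Fintype V] [DecidableEq V] {Ω : Type*} [MeasurableSpace Ω] (P : Measure Ω)
    (ρ θ : V → ℝ) (dstar : V) (dec : ℕ → Ω → V) (T : ℕ) : ℝ :=
  ρ dstar * θ dstar * T -
    ∑ d, ρ d * θ d * ∫ ω, (countBefore (fun n => dec n ω) d T : ℝ) ∂P

end Bandit

end

end GORS

namespace GORS

/-! ### The Bernoulli divergence as a real function -/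

/-! Regret is the gap-weighted sum of expected selection counts (`regret_eq_sum`), so each
suboptimal decision can be treated separately. The estimates are pathwise: almost surely a count is
at most its deterministic logarithmic term plus an integrable random variable independent of `T`.
They hold for every trajectory, so neither tie-breaking nor dependence between decisions matters;
integrating finishes the proof.

Two integrable variables describe the outcomes. After `A` selections every empirical frequency is
within `t ^ (-1/4)` of its mean (`exists_uniform_concentration`). For a level `q` below the true
mean, `H` bounds `exp (t * klReal (freq) q)` over all `t` with frequency below `q`
(`exists_exp_klReal_bound`); hence once the leadership count exceeds `H`, the index is at least the
level `q`, however few the selections.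

A suboptimal leader `k` has a strictly better neighbour `k'` by unimodality. If `k` has led `s`
times, with `s` large compared with `A + H`, a counting argument gives a late comparison slot at
which the selected decision was already selected linearly often in `s`
(`exists_explored_indexSlot`). If that decision is better than `k`, its empirical mean exceeds that
of `k`, so `k` cannot lead. Otherwise its index is close to its mean, because the exploration
threshold is only logarithmic, while the index of `k'` is clearly above the mean of `k`. Both are
impossible, so `k` leads at most `C * (A + H)` times (`exists_leadership_bound`).

When the best decision leads, forced exploitation has selected it linearly often, so its index,
being at least its empirical mean, is within order `s ^ (-1/4)` of the optimal reward or above it. A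
selected neighbour must reach that level, which bounds its count by the threshold divided by the
divergence, up to the factor `1 + ε` (`exists_index_bound`, `exists_selection_bound`). The
polynomial rate matters when the neighbour's rate equals the optimal reward: the divergence to a
level within `s ^ (-1/4)` of `1` itself grows like `log s`, and the count stays bounded. -/

/-- The Bernoulli divergence as a real number; it is the true divergence when `0 < q < 1`. -/
noncomputable def klReal (p q : ℝ) : ℝ :=
  p * Real.log (p / q) + (1 - p) * Real.log ((1 - p) / (1 - q))

lemma klBernoulli_eq_ofReal {p q : ℝ} (hq0 : 0 < q) (hq1 : q < 1) :
    klBernoulli p q = ENNReal.ofReal (klReal p q) := by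
  simp [klBernoulli, hq0.ne', hq1.ne, klReal]

lemma klBernoulli_self (p : ℝ) : klBernoulli p p = 0 := by
  unfold klBernoulli
  rw [if_neg (by tauto)]
  by_cases h0 : p = 0
  · simp [h0]
  · by_cases h1 : 1 - p = 0
    · simp [h1, h0]
    · simp [h0, h1]

lemma klReal_eq {p q : ℝ} (hq0 : 0 < q) (hq1 : q < 1) :
    klReal p q =
      p * (Real.log p - Real.log q) + (1 - p) * (Real.log (1 - p) - Real.log (1 - q)) := by
  have h1 : p * Real.log (p / q) = p * (Real.log p - Real.log q) := by
    by_cases h : p = 0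
    · simp [h]
    · rw [Real.log_div h hq0.ne']
  have h2 : (1 - p) * Real.log ((1 - p) / (1 - q)) =
      (1 - p) * (Real.log (1 - p) - Real.log (1 - q)) := by
    by_cases h : 1 - p = 0
    · simp [h]
    · rw [Real.log_div h (by linarith)]
  rw [klReal, h1, h2]

lemma log_sub_log_le {a b : ℝ} (ha : 0 < a) (hb : 0 < b) :
    Real.log a - Real.log b ≤ (a - b) / b := by
  rw [← Real.log_div ha.ne' hb.ne', sub_div, div_self hb.ne']
  exact Real.log_le_sub_one_of_pos (div_pos ha hb)

/-- Convexity in the second argument: the added term is the tangent line at `v`, of slope `(v - x) /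
(v * (1 - v))`. It follows from the tangent inequality for each logarithm. -/
lemma klReal_add_le {x v w : ℝ} (hx : 0 ≤ x) (hxv : x ≤ v) (hv : 0 < v) (hvw : v ≤ w)
    (hw : w < 1) : klReal x v + (w - v) * (v - x) / (v * (1 - v)) ≤ klReal x w := by
  have hv1 : 0 < 1 - v := by linarith
  rw [klReal_eq hv (by linarith), klReal_eq (by linarith : 0 < w) hw]
  have h1 := mul_le_mul_of_nonneg_left (log_sub_log_le (by linarith : 0 < w) hv) hx
  have h2 := mul_le_mul_of_nonneg_left (log_sub_log_le (by linarith : 0 < 1 - w) hv1)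
    (by linarith : 0 ≤ 1 - x)
  have h3 : (w - v) * (v - x) / (v * (1 - v)) =
      -(x * ((w - v) / v)) - (1 - x) * ((1 - w - (1 - v)) / (1 - v)) := by
    field_simp
    ring
  rw [h3]
  linarith

lemma klReal_mono_right {x v w : ℝ} (hx : 0 ≤ x) (hxv : x ≤ v) (hv : 0 < v) (hvw : v ≤ w)
    (hw : w < 1) : klReal x v ≤ klReal x w := by
  have h := klReal_add_le hx hxv hv hvw hw
  have : 0 ≤ (w - v) * (v - x) / (v * (1 - v)) :=
    div_nonneg (mul_nonneg (by linarith) (by linarith)) (mul_nonneg hv.le (by linarith))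
  linarith

lemma klReal_nonneg {x v : ℝ} (hx : 0 ≤ x) (hxv : x ≤ v) (hv : 0 < v) (hv1 : v < 1) :
    0 ≤ klReal x v := by
  rcases hx.eq_or_lt with rfl | hx
  · rw [klReal_eq hv hv1]
    have := Real.log_nonpos (by linarith : 0 ≤ 1 - v) (by linarith)
    simpa using this
  · have h := klReal_mono_right hx.le le_rfl hx hxv hv1
    have h1 : x / x = 1 := div_self hx.ne'
    have h2 : (1 - x) / (1 - x) = 1 := div_self (by linarith)
    have h0 : klReal x x = 0 := by simp [klReal, h1, h2]
    linarith

/-- A weak Pinsker inequality. At the midpoint of `x` and `v` the tangent slope is at least `2 * (v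
- x)`, and half of the interval remains. -/
lemma sq_sub_le_klReal {x v : ℝ} (hx : 0 ≤ x) (hxv : x ≤ v) (hv : 0 < v) (hv1 : v < 1) :
    (v - x) ^ 2 ≤ klReal x v := by
  have hy : 0 < (x + v) / 2 := by linarith
  have hy1 : 0 < 1 - (x + v) / 2 := by linarith
  have h := klReal_add_le hx (by linarith) hy (by linarith : (x + v) / 2 ≤ v) hv1
  have h0 := klReal_nonneg hx (by linarith) hy (by linarith : (x + v) / 2 < 1)
  have h1 : (v - x) ^ 2 ≤
      (v - (x + v) / 2) * ((x + v) / 2 - x) / ((x + v) / 2 * (1 - (x + v) / 2)) := by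
    rw [le_div_iff₀ (mul_pos hy hy1)]
    have h4 : (x + v) / 2 * (1 - (x + v) / 2) ≤ 1 / 4 := by
      nlinarith [sq_nonneg ((x + v) / 2 - 1 / 2)]
    nlinarith [sq_nonneg (v - x)]
  linarith

lemma klReal_pos {x v : ℝ} (hx : 0 ≤ x) (hxv : x < v) (hv1 : v < 1) : 0 < klReal x v :=
  lt_of_lt_of_le (by have : 0 < v - x := by linarith
                     positivity) (sq_sub_le_klReal hx hxv.le (by linarith) hv1)

/-- The defect is `x - y` times the increase of the log-odds from `x` to `v`. Besides monotonicity
on the left, this provides the exponential margin in `exists_exp_klReal_bound`. -/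
lemma klReal_add_klReal_le {y x v : ℝ} (hyx : y ≤ x) (hx : 0 < x) (hxv : x ≤ v)
    (hv1 : v < 1) : klReal y x + klReal x v ≤ klReal y v := by
  rw [klReal_eq hx (by linarith), klReal_eq (by linarith : 0 < v) hv1,
    klReal_eq (by linarith : 0 < v) hv1]
  have h1 : Real.log x ≤ Real.log v := Real.log_le_log hx hxv
  have h2 : Real.log (1 - v) ≤ Real.log (1 - x) := Real.log_le_log (by linarith) (by linarith)
  nlinarith [mul_nonneg (sub_nonneg.2 hyx) (sub_nonneg.2 h1),
    mul_nonneg (sub_nonneg.2 hyx) (sub_nonneg.2 h2)]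

lemma klReal_anti_left {y x v : ℝ} (hy : 0 ≤ y) (hyx : y ≤ x) (hx : 0 < x) (hxv : x ≤ v)
    (hv1 : v < 1) : klReal x v ≤ klReal y v := by
  have h := klReal_add_klReal_le hyx hx hxv hv1
  have := klReal_nonneg hy hyx hx (by linarith)
  linarith

/-! ### The index -/

lemma coe_ofReal_le_coe_iff {a L : ℝ} (hL : 0 ≤ L) :
    ((ENNReal.ofReal a : ℝ≥0∞) : EReal) ≤ (L : EReal) ↔ a ≤ L := by
  rw [EReal.coe_ennreal_ofReal, EReal.coe_le_coe_iff]
  simp [hL]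

lemma klIndex_le {c R μ : ℝ} {t l : ℕ} (hR : 0 ≤ R) : klIndex c R μ t l ≤ R :=
  Real.sSup_le (fun _ hq => hq.1.2) hR

lemma le_klIndex {c R μ q : ℝ} {t l : ℕ} (hq : q ∈ Set.Icc 0 R) (hl : 2 ≤ l)
    (h : (((t : ℝ≥0∞) * klBernoulli (μ / R) (q / R) : ℝ≥0∞) : EReal) ≤
      ((Real.log l + c * Real.log (Real.log l) : ℝ) : EReal)) : q ≤ klIndex c R μ t l :=
  le_csSup ⟨R, fun _ hy => hy.1.2⟩ ⟨hq, hl, h⟩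

lemma self_le_klIndex {c R μ : ℝ} {t l : ℕ} (hμ : μ ∈ Set.Icc 0 R) (hl : 2 ≤ l)
    (hL : 0 ≤ Real.log l + c * Real.log (Real.log l)) : μ ≤ klIndex c R μ t l := by
  apply le_klIndex hμ hl
  rw [klBernoulli_self, mul_zero, EReal.coe_ennreal_zero]
  exact EReal.coe_nonneg.2 hL

lemma natCast_mul_klBernoulli {p q : ℝ} (t : ℕ) (hq0 : 0 < q) (hq1 : q < 1) :
    (t : ℝ≥0∞) * klBernoulli p q = ENNReal.ofReal (t * klReal p q) := by
  rw [klBernoulli_eq_ofReal hq0 hq1, ENNReal.ofReal_mul (by positivity), ENNReal.ofReal_natCast]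

lemma le_klIndex_of_klReal_le {c R x q : ℝ} {t l : ℕ} (hR : 0 < R) (hq0 : 0 < q) (hq1 : q < 1)
    (hl : 2 ≤ l) (hL : 0 ≤ Real.log l + c * Real.log (Real.log l))
    (h : t * klReal x q ≤ Real.log l + c * Real.log (Real.log l)) :
    R * q ≤ klIndex c R (R * x) t l := by
  apply le_klIndex ⟨by positivity, by nlinarith⟩ hl
  rw [mul_div_cancel_left₀ _ hR.ne', mul_div_cancel_left₀ _ hR.ne',
    natCast_mul_klBernoulli t hq0 hq1, coe_ofReal_le_coe_iff hL]
  exact h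

/-- Some admissible `q` lies above `R * v`, and the divergence increases to the right of `x`. This
turns a large index into an upper bound on the number of selections. -/
lemma klReal_le_of_lt_klIndex {c R x v : ℝ} {t l : ℕ} (hR : 0 < R) (hx : 0 ≤ x) (hxv : x ≤ v)
    (hv : 0 < v) (hlt : R * v < klIndex c R (R * x) t l) :
    v < 1 ∧ t * klReal x v ≤ Real.log l + c * Real.log (Real.log l) := by
  have hv1 : v < 1 := by
    have h := hlt.trans_le (klIndex_le hR.le)
    nlinarith
  refine ⟨hv1, ?_⟩
  unfold klIndex at hlt
  set S := {q : ℝ | q ∈ Set.Icc 0 R ∧ 2 ≤ l ∧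
    (((t : ℝ≥0∞) * klBernoulli (R * x / R) (q / R) : ℝ≥0∞) : EReal) ≤
      ((Real.log l + c * Real.log (Real.log l) : ℝ) : EReal)} with hS
  have hne : S.Nonempty := by
    by_contra hne
    rw [Set.not_nonempty_iff_eq_empty] at hne
    rw [hne, Real.sSup_empty] at hlt
    have : 0 < R * v := by positivity
    linarith
  obtain ⟨q, ⟨⟨_, hqR⟩, _, hq⟩, hvq⟩ := exists_lt_of_lt_csSup hne hlt
  rw [mul_div_cancel_left₀ _ hR.ne'] at hq
  have hL : 0 ≤ Real.log l + c * Real.log (Real.log l) := by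
    have := (EReal.coe_ennreal_nonneg _).trans hq
    exact_mod_cast this
  have hvq' : v < q / R := by rw [lt_div_iff₀ hR]; linarith
  rcases (show q / R ≤ 1 from (div_le_one hR).2 hqR).eq_or_lt with h1 | h1
  -- At the end point the divergence is infinite since `x < 1`, so `q` can be admissible only when
  -- `t = 0`.
  · have htop : klBernoulli x (q / R) = ⊤ := by
      unfold klBernoulli
      rw [if_pos (Or.inr ⟨h1, by linarith⟩)]
    rcases Nat.eq_zero_or_pos t with rfl | ht
    · simpa using hL
    · rw [htop, ENNReal.mul_top (by exact_mod_cast ht.ne'), EReal.coe_ennreal_top] at hq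
      exact absurd hq (not_le.2 (EReal.coe_lt_top _))
  · rw [natCast_mul_klBernoulli t (by linarith) h1, coe_ofReal_le_coe_iff hL] at hq
    exact (mul_le_mul_of_nonneg_left (klReal_mono_right hx hxv hv hvq'.le h1)
      (by positivity)).trans hq

/-! ### How often a decision can have an index close to a given level -/

lemma exists_klReal_perturb {θ w ε : ℝ} (hθ : 0 ≤ θ) (hθw : θ < w) (hw : w < 1) (hε : 0 < ε) :
    ∃ z, 0 < z ∧ θ + z < w - z ∧ klReal θ w ≤ (1 + ε) * klReal (θ + z) (w - z) := by
  have hpos := klReal_pos hθ hθw hw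
  -- The product `(θ + z) * log (θ + z)` is kept whole: it is continuous at `0` even when `θ = 0`,
  -- where the logarithm alone is not.
  let g : ℝ → ℝ := fun z => (θ + z) * Real.log (θ + z) - (θ + z) * Real.log (w - z) +
    (1 - (θ + z)) * (Real.log (1 - (θ + z)) - Real.log (1 - (w - z)))
  have hg : ContinuousAt g 0 := by
    have h1 : ContinuousAt (fun z : ℝ => (θ + z) * Real.log (θ + z)) 0 :=
      (Real.continuous_mul_log.comp (continuous_const.add continuous_id)).continuousAt
    have h2 : ContinuousAt (fun z : ℝ => Real.log (w - z)) 0 :=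
      ContinuousAt.log (by fun_prop) (by simp; linarith)
    have h3 : ContinuousAt (fun z : ℝ => Real.log (1 - (θ + z))) 0 :=
      ContinuousAt.log (by fun_prop) (by simp; linarith)
    have h4 : ContinuousAt (fun z : ℝ => Real.log (1 - (w - z))) 0 :=
      ContinuousAt.log (by fun_prop) (by simp; linarith)
    have h5 : ContinuousAt (fun z : ℝ => θ + z) 0 := by fun_prop
    have h6 : ContinuousAt (fun z : ℝ => 1 - (θ + z)) 0 := by fun_prop
    exact (h1.sub (h5.mul h2)).add (h6.mul (h3.sub h4))
  have hgk : ∀ z, 0 < w - z → w - z < 1 → g z = klReal (θ + z) (w - z) := by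
    intro z h1 h2
    rw [klReal_eq h1 h2]
    simp only [g]
    ring
  have hg0 : g 0 = klReal θ w := by
    rw [hgk 0 (by linarith) (by linarith)]
    simp
  have hlim : ∀ᶠ z in nhds (0 : ℝ), klReal θ w / (1 + ε) < g z := by
    apply hg.eventually (lt_mem_nhds _)
    rw [hg0]
    exact div_lt_self hpos (by linarith)
  have hsmall : ∀ᶠ z in nhds (0 : ℝ), z < (w - θ) / 2 := gt_mem_nhds (by linarith)
  have hpos' : ∀ᶠ z in nhdsWithin (0 : ℝ) (Set.Ioi 0), 0 < z := eventually_mem_nhdsWithin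
  obtain ⟨z, hz0, hz1, hz2⟩ := (hpos'.and ((hlim.and hsmall).filter_mono
    nhdsWithin_le_nhds)).exists
  refine ⟨z, hz0, by linarith, ?_⟩
  rw [hgk z (by linarith) (by linarith), div_lt_iff₀ (by linarith)] at hz1
  linarith

lemma tendsto_mul_natCast_rpow_neg (b : ℝ) :
    Tendsto (fun s : ℕ => b * (s : ℝ) ^ (-(1 / 4) : ℝ)) atTop (nhds 0) := by
  have h := ((tendsto_rpow_neg_atTop (by norm_num : (0 : ℝ) < 1 / 4)).comp
    tendsto_natCast_atTop_atTop).const_mul b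
  simpa using h

/-- The coefficient of `log s + c log log s` in the bound for the number of selections of a
neighbour of success probability `θ` and rate `ρ` of a leader of expected reward `μ`. -/
noncomputable def rateCoeff (ρ θ μ ε : ℝ) : ℝ :=
  if μ ≤ ρ then (1 + ε) * ((klBernoulli θ (μ / ρ))⁻¹).toReal else 0

lemma rateCoeff_nonneg {ρ θ μ ε : ℝ} (hε : 0 < ε) : 0 ≤ rateCoeff ρ θ μ ε := by
  unfold rateCoeff
  split_ifs
  · positivity
  · exact le_rfl

lemma rateCoeff_of_eq {ρ θ ε : ℝ} (hρ : 0 < ρ) (hθ : θ < 1) : rateCoeff ρ θ ρ ε = 0 := by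
  have : klBernoulli θ 1 = ⊤ := by
    unfold klBernoulli
    rw [if_pos (Or.inr ⟨rfl, hθ.ne⟩)]
  simp [rateCoeff, div_self hρ.ne', this]

lemma rateCoeff_of_lt {ρ θ μ ε : ℝ} (hρ : 0 < ρ) (hμ0 : 0 < μ) (hθ : 0 ≤ θ) (hμ : ρ * θ < μ)
    (h : μ < ρ) : rateCoeff ρ θ μ ε = (1 + ε) / klReal θ (μ / ρ) := by
  have hw : μ / ρ < 1 := (div_lt_one hρ).2 h
  have hθw : θ < μ / ρ := by rw [lt_div_iff₀ hρ]; linarith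
  rw [rateCoeff, if_pos h.le, klBernoulli_eq_ofReal (div_pos hμ0 hρ) hw, ENNReal.toReal_inv,
    ENNReal.toReal_ofReal (klReal_pos hθ hθw hw).le, div_eq_mul_inv (1 + ε)]

/-- If the index of a suboptimal decision is at least the optimal reward `μ` up to a polynomially
small error, then the decision has been selected at most about `log s / I` times. -/
lemma exists_index_bound {ρ θ μ c ε : ℝ} (hρ : 0 < ρ) (hθ : 0 ≤ θ) (hμ : ρ * θ < μ)
    (hc : 0 < c) (hε : 0 < ε) (b : ℝ) (hb : 0 < b) :
    ∃ η t₁ : ℝ, ∃ s₀ : ℕ, 0 < η ∧ ∀ s t : ℕ, s₀ ≤ s → ∀ x, 0 ≤ x → x ≤ θ + η →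
      μ - b * (s : ℝ) ^ (-(1 / 4) : ℝ) < klIndex c ρ (ρ * x) t s →
        (t : ℝ) ≤ rateCoeff ρ θ μ ε * (Real.log s + c * Real.log (Real.log s)) + t₁ := by
  have hμ0 : 0 < μ := lt_of_le_of_lt (by positivity) hμ
  rcases lt_trichotomy ρ μ with h | h | h
  -- Rate below `μ`: an index never exceeds the rate, so the hypothesis fails for large `s`.
  · have hev : ∀ᶠ s : ℕ in atTop, b * (s : ℝ) ^ (-(1 / 4) : ℝ) < μ - ρ :=
      (tendsto_mul_natCast_rpow_neg b).eventually (gt_mem_nhds (by linarith))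
    obtain ⟨s₀, hs₀⟩ := eventually_atTop.1 hev
    refine ⟨1, 0, s₀, one_pos, fun s t hs x _ _ hlt => ?_⟩
    have h1 := hs₀ s hs
    have h2 := klIndex_le (c := c) (μ := ρ * x) (t := t) (l := s) hρ.le
    linarith
  -- Rate equal to `μ`: the coefficient is zero and the count must be bounded. The level is `1 - z`
  -- with `z` of order `s ^ (-1/4)`, so `-(1 - y) * log z` makes the divergence comparable to `log
  -- s`.
  · subst h
    have hθ1 : θ < 1 := by nlinarith
    rw [rateCoeff_of_eq hρ hθ1]
    set y := (1 + θ) / 2 with hy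
    have hy0 : 0 < y := by positivity
    have hy1 : y < 1 := by linarith
    -- the entropy constant
    set h := y * Real.log y + (1 - y) * Real.log (1 - y) with hh
    have hlogs : Tendsto (fun s : ℕ => Real.log (s : ℝ)) atTop atTop :=
      Real.tendsto_log_atTop.comp tendsto_natCast_atTop_atTop
    have hev1 : ∀ᶠ s : ℕ in atTop, b / ρ * (s : ℝ) ^ (-(1 / 4) : ℝ) < 1 - y :=
      (tendsto_mul_natCast_rpow_neg (b / ρ)).eventually (gt_mem_nhds (by linarith))
    -- The main term is `(1 - y) / 4 * log s`; half of it is given up to absorb the constants.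
    have hev2 : ∀ᶠ s : ℕ in atTop,
        8 * ((1 - y) * Real.log (b / ρ) - h) / (1 - y) ≤ Real.log (s : ℝ) :=
      hlogs.eventually_ge_atTop _
    have hev3 : ∀ᶠ s : ℕ in atTop, 1 ≤ Real.log (s : ℝ) := hlogs.eventually_ge_atTop _
    obtain ⟨s₀, hs₀⟩ := eventually_atTop.1 (hev1.and (hev2.and (hev3.and (eventually_ge_atTop 1))))
    refine ⟨(1 - θ) / 2, 8 * (1 + c) / (1 - y), s₀, by linarith, fun s t hs x hx hxη hlt => ?_⟩
    obtain ⟨h1, h2, h3, h4⟩ := hs₀ s hs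
    have hs0 : (0 : ℝ) < s := by exact_mod_cast h4
    have hz : 0 < b / ρ * (s : ℝ) ^ (-(1 / 4) : ℝ) := by positivity
    set z := b / ρ * (s : ℝ) ^ (-(1 / 4) : ℝ) with hzdef
    have hxy : x ≤ y := by linarith
    have hlt' : ρ * (1 - z) < klIndex c ρ (ρ * x) t s := by
      have : ρ * (1 - z) = ρ - b * (s : ℝ) ^ (-(1 / 4) : ℝ) := by
        rw [hzdef]; field_simp
      rw [this]; exact hlt
    obtain ⟨hv1, hbd⟩ := klReal_le_of_lt_klIndex hρ hx (by linarith) (by linarith) hlt'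
    have hanti := klReal_anti_left hx hxy hy0 (by linarith) hv1
    have hlogz : Real.log z = Real.log (b / ρ) - 1 / 4 * Real.log s := by
      rw [hzdef, Real.log_mul (by positivity) (by positivity), Real.log_rpow hs0]
      ring
    have hlow : (1 - y) / 8 * Real.log s ≤ klReal y (1 - z) := by
      rw [klReal_eq (by linarith) hv1, sub_sub_cancel, hlogz]
      have h5 : Real.log (1 - z) ≤ 0 := Real.log_nonpos (by linarith) (by linarith)
      rw [div_le_iff₀ (by linarith)] at h2
      nlinarith [mul_nonneg hy0.le (neg_nonneg.2 h5)]
    have hloglog : Real.log (Real.log s) ≤ Real.log s :=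
      (Real.log_le_sub_one_of_pos (by linarith)).trans (by linarith)
    have h6 : (t : ℝ) * ((1 - y) / 8 * Real.log s) ≤ (1 + c) * Real.log s := by
      have := mul_le_mul_of_nonneg_left (hlow.trans hanti) (Nat.cast_nonneg (α := ℝ) t)
      nlinarith
    have h7 : (t : ℝ) * ((1 - y) / 8) ≤ 1 + c := by
      rw [← mul_assoc] at h6
      exact le_of_mul_le_mul_right h6 (by linarith)
    rw [zero_mul, zero_add, le_div_iff₀ (by linarith)]
    linarith
  -- Rate above `μ`: moving both arguments of the divergence by a fixed `z` costs only the factor `1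
  -- + ε`.
  · rw [rateCoeff_of_lt hρ hμ0 hθ hμ h]
    have hw : μ / ρ < 1 := (div_lt_one hρ).2 h
    have hθw : θ < μ / ρ := by rw [lt_div_iff₀ hρ]; linarith
    obtain ⟨z, hz, hθz, hkl⟩ := exists_klReal_perturb hθ hθw hw hε
    have hev : ∀ᶠ s : ℕ in atTop, b * (s : ℝ) ^ (-(1 / 4) : ℝ) < ρ * z :=
      (tendsto_mul_natCast_rpow_neg b).eventually (gt_mem_nhds (by positivity))
    obtain ⟨s₀, hs₀⟩ := eventually_atTop.1 hev
    refine ⟨z, 0, s₀, hz, fun s t hs x hx hxz hlt => ?_⟩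
    have hlt' : ρ * (μ / ρ - z) < klIndex c ρ (ρ * x) t s := by
      have h1 := hs₀ s hs
      have : ρ * (μ / ρ - z) = μ - ρ * z := by field_simp
      linarith
    obtain ⟨hv1, hbd⟩ := klReal_le_of_lt_klIndex hρ hx (by linarith) (by linarith) hlt'
    have hanti := klReal_anti_left hx hxz (by linarith) hθz.le hv1
    have hpos := klReal_pos hθ hθw hw
    have h2 := mul_le_mul_of_nonneg_left hanti (Nat.cast_nonneg (α := ℝ) t)
    rw [add_zero, div_mul_eq_mul_div, le_div_iff₀ hpos]
    have h3 := mul_le_mul_of_nonneg_left hkl (Nat.cast_nonneg (α := ℝ) t)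
    have h4 := mul_le_mul_of_nonneg_left (h2.trans hbd) (by linarith : 0 ≤ 1 + ε)
    linarith

/-! ### Counting along a trajectory -/

/-- Empirical success frequency of `d` after `t` selections. -/
noncomputable def freq {V : Type*} (x : V → ℕ → ℝ) (d : V) (t : ℕ) : ℝ := (∑ i ∈ Finset.range t, x d i) / t

lemma freq_mem_Icc {V : Type*} {x : V → ℕ → ℝ} (hx : ∀ d i, x d i = 0 ∨ x d i = 1) (d : V) (t : ℕ) :
    freq x d t ∈ Set.Icc (0 : ℝ) 1 := by
  have h0 : 0 ≤ ∑ i ∈ Finset.range t, x d i :=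
    Finset.sum_nonneg fun i _ => by rcases hx d i with h | h <;> simp [h]
  have h1 : ∑ i ∈ Finset.range t, x d i ≤ t := by
    have := Finset.sum_le_card_nsmul (Finset.range t) (x d) 1
      fun i _ => by rcases hx d i with h | h <;> simp [h]
    simpa using this
  exact ⟨div_nonneg h0 (by positivity), div_le_one_of_le₀ h1 (by positivity)⟩

section Counting

variable {V : Type*} [DecidableEq V]

lemma countBefore_succ (u : ℕ → V) (d : V) (n : ℕ) :
    countBefore u d (n + 1) = countBefore u d n + if u n = d then 1 else 0 := by
  unfold countBefore
  rw [Finset.range_add_one, Finset.filter_insert]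
  split_ifs with h
  · rw [Finset.card_insert_of_notMem (by simp)]
  · rfl

lemma countBefore_mono (u : ℕ → V) (d : V) : Monotone (countBefore u d) :=
  monotone_nat_of_le_succ fun n => by rw [countBefore_succ]; omega

lemma countBefore_lt {u : ℕ → V} {d : V} {m n : ℕ} (hm : u m = d) (hmn : m < n) :
    countBefore u d m < countBefore u d n := by
  have h := countBefore_mono u d (Nat.succ_le_of_lt hmn)
  rw [Nat.succ_eq_add_one, countBefore_succ, if_pos hm] at h
  omega

lemma countBefore_le (u : ℕ → V) (d : V) (n : ℕ) : countBefore u d n ≤ n := by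
  simpa [countBefore] using Finset.card_filter_le (Finset.range n) (fun m => u m = d)

lemma countBefore_injOn (u : ℕ → V) (d : V) : Set.InjOn (countBefore u d) {m | u m = d} := by
  intro m hm n hn h
  rcases lt_trichotomy m n with hlt | rfl | hlt
  · have := countBefore_lt hm hlt
    omega
  · rfl
  · have := countBefore_lt hn hlt
    omega

lemma exists_countBefore_eq {u : ℕ → V} {d : V} {n v : ℕ} (hv : v < countBefore u d n) :
    ∃ m < n, u m = d ∧ countBefore u d m = v := by
  induction n with
  | zero => simp [countBefore] at hv
  | succ n ih =>
    by_cases h : v < countBefore u d n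
    · obtain ⟨m, hm, h⟩ := ih h
      exact ⟨m, by omega, h⟩
    · rw [countBefore_succ] at hv
      split_ifs at hv with hu
      · exact ⟨n, by omega, hu, by omega⟩
      · omega

lemma card_le_of_countBefore_lt {u : ℕ → V} {d : V} {S : Finset ℕ} {b : ℕ}
    (hu : ∀ m ∈ S, u m = d) (hb : ∀ m ∈ S, countBefore u d m < b) : S.card ≤ b := by
  have h := Finset.card_le_card_of_injOn (t := Finset.range b) (countBefore u d)
    (fun m hm => by simpa using hb m hm) ((countBefore_injOn u d).mono fun m hm => hu m hm)
  simpa using h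

lemma card_le_of_countBefore_le {u : ℕ → V} {d : V} {S : Finset ℕ} {b : ℝ} (hb0 : 0 ≤ b)
    (hu : ∀ m ∈ S, u m = d) (hb : ∀ m ∈ S, (countBefore u d m : ℝ) ≤ b) : (S.card : ℝ) ≤ b + 1 := by
  have h := card_le_of_countBefore_lt (b := ⌊b⌋₊ + 1) hu
    fun m hm => Nat.lt_succ_of_le (Nat.le_floor (hb m hm))
  have h2 := Nat.floor_le hb0
  have h3 : (S.card : ℝ) ≤ (⌊b⌋₊ : ℝ) + 1 := by exact_mod_cast h
  linarith

lemma sum_countBefore [Fintype V] (u : ℕ → V) (n : ℕ) : ∑ d, countBefore u d n = n := by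
  have h := Finset.card_eq_sum_card_fiberwise (f := u) (s := Finset.range n) (t := Finset.univ)
    (fun _ _ => Finset.mem_coe.2 (Finset.mem_univ _))
  rw [Finset.card_range] at h
  exact h.symm

lemma empMean_eq (ρ : V → ℝ) (x : V → ℕ → ℝ) (dec : ℕ → V) (d : V) (n : ℕ) :
    empMean ρ x dec d n = ρ d * freq x d (countBefore dec d n) := by
  rw [empMean, freq, ← Finset.mul_sum, mul_div_assoc]

variable [Fintype V] {G : SimpleGraph V} {ρ : V → ℝ} {c : ℝ} {p : ℕ} {x : V → ℕ → ℝ}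
  {dec lead : ℕ → V}

/-- The leader is selected at a linear rate in the number of its leaderships. -/
lemma IsTrajectory.leadership_div_le (h : IsTrajectory G ρ c p x dec lead) (hp : 2 ≤ p) (k : V)
    (n : ℕ) :
    countBefore lead k n / p ≤ countBefore dec k n + Fintype.card V := by
  set s := countBefore lead k n with hs
  -- The leadership count rises by unit steps and takes each value `j * p + 1` below `s`; such a
  -- slot, unless among the initial ones, selects `k`.
  have hex : ∀ j ∈ Finset.range (s / p), ∃ m < n, lead m = k ∧ countBefore lead k m = j * p + 1 := by
    intro j hj
    apply exists_countBefore_eq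
    have h1 : (j + 1) * p ≤ s :=
      (Nat.mul_le_mul_right p (Finset.mem_range.1 hj)).trans (Nat.div_mul_le_self s p)
    rw [add_mul] at h1
    omega
  choose! f hf using hex
  have hcard := Finset.card_le_card_of_injOn (s := Finset.range (s / p))
    (t := (Finset.range n).filter (fun m => dec m = k) ∪ Finset.range (Fintype.card V)) f
    (fun j hj => ?_) (fun i hi j hj hij => ?_)
  · rw [Finset.card_range] at hcard
    refine hcard.trans ((Finset.card_union_le _ _).trans ?_)
    rw [Finset.card_range]
    exact le_rfl
  · obtain ⟨h1, h2, h3⟩ := hf j hj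
    rw [Finset.coe_union, Set.mem_union, Finset.mem_coe, Finset.mem_coe, Finset.mem_filter,
      Finset.mem_range, Finset.mem_range]
    by_cases hD : f j < Fintype.card V
    · exact Or.inr hD
    · exact Or.inl ⟨h1, (h.exploit _ (not_lt.1 hD) ⟨j, by rw [h2, h3]⟩).trans h2⟩
  · have h1 := (hf i hi).2.2
    rw [hij, (hf j hj).2.2] at h1
    have : j * p = i * p := by omega
    exact (Nat.eq_of_mul_eq_mul_right (by omega) this).symm

lemma IsTrajectory.le_countBefore_dec (h : IsTrajectory G ρ c p x dec lead) (hp : 2 ≤ p) (k : V)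
    (n : ℕ) (hs : 2 * p * (Fintype.card V + 1) ≤ (countBefore lead k n : ℝ)) :
    (countBefore lead k n : ℝ) / (2 * p) ≤ countBefore dec k n := by
  have h1 := h.leadership_div_le hp k n
  have h2 := Nat.lt_div_mul_add (a := countBefore lead k n) (b := p) (by omega)
  have hp0 : (0 : ℝ) < p := by exact_mod_cast (by omega : 0 < p)
  have h3 : countBefore lead k n ≤ (countBefore dec k n + Fintype.card V + 1) * p := by
    rw [add_mul _ 1]
    nlinarith
  have h4 : (countBefore lead k n : ℝ) ≤ (countBefore dec k n + Fintype.card V + 1) * p := by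
    exact_mod_cast h3
  rw [div_le_iff₀ (by positivity)]
  nlinarith

/-- The slots before `n` of leader `k` at which the selection is made by comparison of indices. -/
noncomputable def indexSlots (p : ℕ) (lead : ℕ → V) (k : V) (n : ℕ) : Finset ℕ :=
  open Classical in
  (Finset.range n).filter fun m => lead m = k ∧ Fintype.card V ≤ m ∧
    ¬ ∃ j : ℕ, countBefore lead k m = j * p + 1

lemma mem_indexSlots {k : V} {n m : ℕ} : m ∈ indexSlots p lead k n ↔
    m < n ∧ lead m = k ∧ Fintype.card V ≤ m ∧ ¬ ∃ j : ℕ, countBefore lead k m = j * p + 1 := by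
  simp [indexSlots]

/-- Forced slots have distinct leadership counts `j * p + 1`, and `2 ≤ p` leaves at most half of the
leaderships forced. A fixed fraction of them therefore compares indices. -/
lemma countBefore_le_card_indexSlots (hp : 2 ≤ p) (k : V) (n : ℕ) :
    countBefore lead k n ≤
      (indexSlots p lead k n).card + Fintype.card V + countBefore lead k n / 2 := by
  classical
  set E := (Finset.range n).filter fun m => lead m = k ∧
    ∃ j : ℕ, countBefore lead k m = j * p + 1 with hE
  have hsub : (Finset.range n).filter (fun m => lead m = k) ⊆
      indexSlots p lead k n ∪ Finset.range (Fintype.card V) ∪ E := by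
    intro m hm
    rw [Finset.mem_filter, Finset.mem_range] at hm
    rw [Finset.mem_union, Finset.mem_union, mem_indexSlots, Finset.mem_range, hE, Finset.mem_filter,
      Finset.mem_range]
    have := lt_or_ge m (Fintype.card V)
    tauto
  have hEcard : E.card ≤ countBefore lead k n / 2 := by
    have h := Finset.card_le_card_of_injOn (s := E)
      (t := Finset.range (countBefore lead k n / 2)) (fun m => (countBefore lead k m - 1) / p)
      (fun m hm => ?_) (fun m hm m' hm' hmm => ?_)
    · simpa using h
    · rw [hE, Finset.mem_coe, Finset.mem_filter, Finset.mem_range] at hm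
      obtain ⟨hmn, hk, j, hj⟩ := hm
      have h1 := countBefore_lt hk hmn
      have h2 : 2 * j ≤ j * p := by nlinarith
      simp only [hj, Nat.add_sub_cancel, Nat.mul_div_cancel j (by omega : 0 < p), Finset.coe_range,
        Set.mem_Iio]
      omega
    · rw [hE, Finset.mem_coe, Finset.mem_filter, Finset.mem_range] at hm hm'
      obtain ⟨_, hk, j, hj⟩ := hm
      obtain ⟨_, hk', j', hj'⟩ := hm'
      simp only [hj, hj', Nat.add_sub_cancel, Nat.mul_div_cancel _ (by omega : 0 < p)] at hmm
      exact countBefore_injOn lead k hk hk' (by rw [hj, hj', hmm])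
  have h1 := Finset.card_le_card hsub
  have h2 := Finset.card_union_le (indexSlots p lead k n ∪ Finset.range (Fintype.card V)) E
  have h3 := Finset.card_union_le (indexSlots p lead k n) (Finset.range (Fintype.card V))
  rw [Finset.card_range] at h3
  change countBefore lead k n ≤ _ at h1
  omega

end Counting

/-! ### Concentration of the empirical frequencies -/

section Probability

variable {V Ω : Type*} [MeasurableSpace Ω] {P : Measure Ω} {θ : V → ℝ} {X : V → ℕ → Ω → ℝ}

/-- The bound is the sum of the series, whose integral is finite by Tonelli; it is a crude
substitute for a supremum. -/
lemma exists_integrable_bound {f : ℕ → Ω → ℝ≥0∞} (hf : ∀ n, Measurable (f n)) {g : ℕ → ℝ}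
    (hg : Summable g) (hfg : ∀ n, ∫⁻ ω, f n ω ∂P ≤ ENNReal.ofReal (g n)) :
    ∃ B : Ω → ℝ, Integrable B P ∧ (∀ ω, 0 ≤ B ω) ∧
      ∀ᵐ ω ∂P, ∀ n, f n ω ≤ ENNReal.ofReal (B ω) := by
  have hfin : ∫⁻ ω, ∑' n, f n ω ∂P ≠ ⊤ := by
    rw [lintegral_tsum fun n => (hf n).aemeasurable]
    exact ne_top_of_le_ne_top hg.tsum_ofReal_ne_top (ENNReal.tsum_le_tsum hfg)
  have hmeas : Measurable fun ω => ∑' n, f n ω := Measurable.tsum hf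
  refine ⟨fun ω => (∑' n, f n ω).toReal, integrable_toReal_of_lintegral_ne_top hmeas.aemeasurable
    hfin, fun ω => ENNReal.toReal_nonneg, ?_⟩
  filter_upwards [ae_lt_top hmeas hfin] with ω hω n
  rw [ENNReal.ofReal_toReal hω.ne]
  exact ENNReal.le_tsum n

lemma BernoulliOutcomes.measurableSet_eq_one (hX : BernoulliOutcomes P θ X) (d : V) (i : ℕ) :
    MeasurableSet {ω | X d i ω = 1} := hX.measurable d i (measurableSet_singleton 1)

lemma BernoulliOutcomes.measurable_freq (hX : BernoulliOutcomes P θ X) (d : V) (t : ℕ) :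
    Measurable fun ω => freq (fun d i => X d i ω) d t :=
  (Finset.measurable_fun_sum _ fun i _ => hX.measurable d i).div_const _

lemma BernoulliOutcomes.integral_eq (hX : BernoulliOutcomes P θ X) {d : V} (hθ : 0 ≤ θ d) (i : ℕ) :
    ∫ ω, X d i ω ∂P = θ d := by
  have h : X d i = Set.indicator {ω | X d i ω = 1} 1 := by
    ext ω
    rcases hX.binary d i ω with h | h <;> simp [Set.indicator, h]
  rw [h, integral_indicator_one (hX.measurableSet_eq_one d i), measureReal_def, hX.mean,
    ENNReal.toReal_ofReal hθ]

variable [IsProbabilityMeasure P]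

/-- Two-sided Hoeffding inequality, from the sub-Gaussian bound for variables in `[0, 1]`. -/
lemma BernoulliOutcomes.measure_abs_sum_ge (hX : BernoulliOutcomes P θ X) {d : V}
    (hθ : 0 ≤ θ d) (t : ℕ) {ε : ℝ} (hε : 0 ≤ ε) :
    P.real {ω | ε ≤ |∑ i ∈ Finset.range t, (X d i ω - θ d)|} ≤ 2 * Real.exp (-2 * ε ^ 2 / t) := by
  have hsub : ∀ i, HasSubgaussianMGF (fun ω => X d i ω - θ d) ((‖(1 : ℝ) - 0‖₊ / 2) ^ 2) P := by
    intro i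
    have h := hasSubgaussianMGF_of_mem_Icc (X := X d i) (a := 0) (b := 1) (μ := P)
      (hX.measurable d i).aemeasurable
      (ae_of_all _ fun ω => by rcases hX.binary d i ω with h | h <;> simp [h])
    rwa [hX.integral_eq hθ] at h
  have hind : iIndepFun (fun i ω => X d i ω - θ d) P :=
    (hX.indep d).comp (fun _ y => y - θ d) fun _ => measurable_id.sub_const _
  have hind' : iIndepFun (fun i ω => -(X d i ω - θ d)) P :=
    (hX.indep d).comp (fun _ y => -(y - θ d)) fun _ => (measurable_id.sub_const _).neg
  have hexp : Real.exp (-ε ^ 2 / (2 * t * ((‖(1 : ℝ) - 0‖₊ / 2) ^ 2 : NNReal))) =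
      Real.exp (-2 * ε ^ 2 / t) := by
    congr 1
    rcases eq_or_ne (t : ℝ) 0 with h | h
    · simp [h]
    · simp
      field_simp
  have h1 := HasSubgaussianMGF.measure_sum_range_ge_le_of_iIndepFun hind (n := t)
    (fun i _ => hsub i) hε
  have h2 := HasSubgaussianMGF.measure_sum_range_ge_le_of_iIndepFun hind' (n := t)
    (fun i _ => (hsub i).neg) hε
  rw [hexp] at h1 h2
  have hcover : {ω | ε ≤ |∑ i ∈ Finset.range t, (X d i ω - θ d)|} ⊆
      {ω | ε ≤ ∑ i ∈ Finset.range t, (X d i ω - θ d)} ∪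
        {ω | ε ≤ ∑ i ∈ Finset.range t, -(X d i ω - θ d)} := by
    intro ω hω
    rw [Set.mem_ofPred_eq, le_abs, ← Finset.sum_neg_distrib] at hω
    exact hω
  have h3 := (measureReal_mono (μ := P) hcover).trans (measureReal_union_le _ _)
  linarith

lemma BernoulliOutcomes.measure_freq_deviation (hX : BernoulliOutcomes P θ X) {d : V}
    (hθ : 0 ≤ θ d) {t : ℕ} (ht : 1 ≤ t) :
    P.real {ω | (t : ℝ) ^ (-(1 / 4) : ℝ) < |freq (fun d i => X d i ω) d t - θ d|} ≤
      23 / (t : ℝ) ^ 3 := by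
  have ht0 : (0 : ℝ) < t := by exact_mod_cast ht
  set e := (t : ℝ) ^ (-(1 / 4) : ℝ) with he
  have he0 : 0 ≤ e := by positivity
  have hsub : {ω | e < |freq (fun d i => X d i ω) d t - θ d|} ⊆
      {ω | t * e ≤ |∑ i ∈ Finset.range t, (X d i ω - θ d)|} := by
    intro ω hω
    have h1 : ∑ i ∈ Finset.range t, (X d i ω - θ d) =
        t * (freq (fun d i => X d i ω) d t - θ d) := by
      rw [Finset.sum_sub_distrib, freq, mul_sub, mul_div_cancel₀ _ ht0.ne']
      simp
    rw [Set.mem_ofPred_eq] at hω ⊢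
    rw [h1, abs_mul, abs_of_pos ht0]
    exact mul_le_mul_of_nonneg_left hω.le ht0.le
  have h1 := (measureReal_mono (μ := P) hsub).trans
    (hX.measure_abs_sum_ge hθ t (mul_nonneg ht0.le he0))
  refine h1.trans ?_
  set y := (t : ℝ) ^ (1 / 2 : ℝ) with hy
  have hye : t * e ^ 2 = y := by
    rw [he, ← Real.rpow_natCast, ← Real.rpow_mul ht0.le, hy]
    nth_rewrite 1 [← Real.rpow_one (t : ℝ)]
    rw [← Real.rpow_add ht0]
    norm_num
  have hy2 : y ^ 2 = t := by
    rw [hy, ← Real.rpow_natCast, ← Real.rpow_mul ht0.le]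
    norm_num
  have hexp : -2 * (t * e) ^ 2 / t = -(2 * y) := by
    rw [← hye]
    field_simp
  rw [hexp, Real.exp_neg]
  -- The sixth power of `2 * √t` is of order `t ^ 3`, so the tail remains summable after being
  -- multiplied by `t`.
  have h2 := Real.pow_div_factorial_le_exp (2 * y) (by positivity) 6
  have h3 : (2 * y) ^ 6 = 64 * (t : ℝ) ^ 3 := by rw [← hy2]; ring
  rw [h3] at h2
  norm_num [Nat.factorial] at h2
  have h4 : (Real.exp (2 * y))⁻¹ ≤ (64 * (t : ℝ) ^ 3 / 720)⁻¹ := inv_anti₀ (by positivity) h2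
  refine (mul_le_mul_of_nonneg_left h4 zero_le_two).trans ?_
  rw [inv_div, ← mul_div_assoc, div_le_div_iff₀ (by positivity) (by positivity)]
  nlinarith [pow_pos ht0 3]

/-- The empirical frequency is within `t ^ (-1/4)` of its mean after an integrable number of
selections. -/
lemma BernoulliOutcomes.exists_concentration (hX : BernoulliOutcomes P θ X) {d : V}
    (hθ : 0 ≤ θ d) :
    ∃ A : Ω → ℝ, Integrable A P ∧ (∀ ω, 1 ≤ A ω) ∧ ∀ᵐ ω ∂P, ∀ t : ℕ, A ω ≤ t →
      |freq (fun d i => X d i ω) d t - θ d| ≤ (t : ℝ) ^ (-(1 / 4) : ℝ) := by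
  set E : ℕ → Set Ω := fun t => {ω | ((t + 1 : ℕ) : ℝ) ^ (-(1 / 4) : ℝ) <
    |freq (fun d i => X d i ω) d (t + 1) - θ d|} with hE
  have hmE : ∀ t, MeasurableSet (E t) := fun t =>
    measurableSet_lt measurable_const
      (measurable_norm.comp ((hX.measurable_freq d (t + 1)).sub_const _))
  -- Weighting the deviation event by its own time makes `B` dominate the last time at which a
  -- deviation occurs.
  obtain ⟨B, hBi, hB0, hB⟩ := exists_integrable_bound (P := P)
    (f := fun t => (E t).indicator fun _ => ENNReal.ofReal ((t + 1 : ℕ) : ℝ))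
    (g := fun t => 23 * (1 / ((t + 1 : ℕ) : ℝ) ^ 2))
    (fun t => measurable_const.indicator (hmE t))
    (((summable_nat_add_iff 1).2 (Real.summable_one_div_nat_pow.2 one_lt_two)).mul_left 23)
    (fun t => by
      have h1 := hX.measure_freq_deviation hθ (t := t + 1) (by omega)
      rw [lintegral_indicator_const (hmE t), ← ofReal_measureReal (measure_ne_top P _),
        ← ENNReal.ofReal_mul (by positivity)]
      apply ENNReal.ofReal_le_ofReal
      refine (mul_le_mul_of_nonneg_left h1 (by positivity)).trans (le_of_eq ?_)
      field_simp)
  refine ⟨fun ω => B ω + 1, hBi.add (integrable_const 1), fun ω => by linarith [hB0 ω], ?_⟩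
  filter_upwards [hB] with ω hω t ht
  obtain ⟨u, rfl⟩ : ∃ u, t = u + 1 := ⟨t - 1, by
    have h1 : (1 : ℝ) ≤ t := by linarith [hB0 ω]
    have : 1 ≤ t := by exact_mod_cast h1
    omega⟩
  by_contra! hcon
  have hmem : ω ∈ E u := hcon
  have h1 := hω u
  rw [Set.indicator_of_mem hmem, ENNReal.ofReal_le_ofReal_iff (hB0 ω)] at h1
  linarith

lemma prod_ite_eq_pow {x : ℕ → ℝ} (hx : ∀ i, x i = 0 ∨ x i = 1) {t j : ℕ} (a : ℝ≥0∞)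
    (h : ∑ i ∈ Finset.range t, x i = j) :
    ∏ i ∈ Finset.range t, (if x i = 1 then a else 1) = a ^ j := by
  have hsum : ∑ i ∈ Finset.range t, x i = (((Finset.range t).filter fun i => x i = 1).card : ℝ) := by
    rw [Finset.card_filter]
    push_cast
    refine Finset.sum_congr rfl fun i _ => ?_
    rcases hx i with h | h <;> simp [h]
  have hj : ((Finset.range t).filter fun i => x i = 1).card = j := by
    exact_mod_cast hsum.symm.trans h
  rw [Finset.prod_ite, Finset.prod_const, Finset.prod_const_one, mul_one, hj]

/-- Markov's inequality for the moment `E[a ^ S]`, which factors by independence. The tilt is `a`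
instead of `exp λ`, so that `a = 0` is allowed; it is needed for the frequency `0`. -/
lemma BernoulliOutcomes.measure_sum_eq_mul_pow_le (hX : BernoulliOutcomes P θ X) {d : V}
    (hθ : θ d ∈ Set.Icc (0 : ℝ) 1) (t j : ℕ) {a : ℝ} (ha : 0 ≤ a) :
    P.real {ω | ∑ i ∈ Finset.range t, X d i ω = j} * a ^ j ≤ (1 - θ d + θ d * a) ^ t := by
  set g : ℝ → ℝ≥0∞ := fun y => if y = 1 then ENNReal.ofReal a else 1 with hg
  have hgm : Measurable g :=
    Measurable.ite (measurableSet_singleton 1) measurable_const measurable_const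
  have hone : ∀ i, ∫⁻ ω, g (X d i ω) ∂P = ENNReal.ofReal (1 - θ d + θ d * a) := by
    intro i
    have hm := hX.measurableSet_eq_one d i
    rw [← lintegral_add_compl _ hm, setLIntegral_congr_fun hm (g := fun _ => ENNReal.ofReal a)
        (fun ω hω => by simp [hg, show X d i ω = 1 from hω]),
      setLIntegral_congr_fun hm.compl (g := fun _ => 1)
        (fun ω hω => by
          have : X d i ω ≠ 1 := hω
          simp [hg, this]), setLIntegral_const, setLIntegral_const, prob_compl_eq_one_sub hm,
      hX.mean, one_mul, ← ENNReal.ofReal_mul ha, ← ENNReal.ofReal_one,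
      ← ENNReal.ofReal_sub _ hθ.1,
      ← ENNReal.ofReal_add (mul_nonneg ha hθ.1) (by linarith [hθ.2])]
    congr 1
    ring
  have hprod := lintegral_prod_eq_prod_lintegral_of_indepFun (Finset.range t)
    (fun i ω => g (X d i ω)) ((hX.indep d).comp (fun _ => g) fun _ => hgm)
    fun i => hgm.comp (hX.measurable d i)
  simp only [hone, Finset.prod_const, Finset.card_range] at hprod
  have hbase : 0 ≤ 1 - θ d + θ d * a := by nlinarith [hθ.1, hθ.2]
  set F := {ω | ∑ i ∈ Finset.range t, X d i ω = j} with hF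
  have hmF : MeasurableSet F :=
    (Finset.measurable_fun_sum _ fun i _ => hX.measurable d i) (measurableSet_singleton (j : ℝ))
  have hle : ∫⁻ ω, F.indicator (fun _ => ENNReal.ofReal a ^ j) ω ∂P ≤
      ∫⁻ ω, ∏ i ∈ Finset.range t, g (X d i ω) ∂P := by
    refine lintegral_mono fun ω => ?_
    by_cases hω : ω ∈ F
    · rw [Set.indicator_of_mem hω]
      exact (prod_ite_eq_pow (fun i => hX.binary d i ω) _ hω).ge
    · rw [Set.indicator_of_notMem hω]
      exact zero_le
  rw [hprod, lintegral_indicator_const hmF, ← ofReal_measureReal (measure_ne_top P _),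
    ← ENNReal.ofReal_pow ha, ← ENNReal.ofReal_pow hbase, ← ENNReal.ofReal_mul (by positivity),
    ENNReal.ofReal_le_ofReal_iff (by positivity)] at hle
  linarith

/-- The right-hand base is the Chernoff tilt optimal for frequency `x` under parameter `v`, and `(1
- v) / (1 - x)` is the resulting moment of one outcome. -/
lemma exp_mul_klReal_mul_pow {x v : ℝ} (hx : 0 ≤ x) (hx1 : x < 1) (hv : 0 < v) (hv1 : v < 1)
    {t j : ℕ} (hj : (j : ℝ) = t * x) :
    Real.exp (t * klReal x v) * ((1 - v) / (1 - x)) ^ t = (x * (1 - v) / ((1 - x) * v)) ^ j := by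
  have h1x : 0 < 1 - x := by linarith
  have h1v : 0 < 1 - v := by linarith
  rw [klReal_eq hv hv1, ← Real.rpow_natCast ((1 - v) / (1 - x)) t,
    Real.rpow_def_of_pos (div_pos h1v h1x), Real.log_div h1v.ne' h1x.ne', ← Real.exp_add]
  rcases hx.eq_or_lt with rfl | hx
  · have : j = 0 := by simpa using hj
    subst this
    rw [pow_zero, Real.exp_eq_one_iff]
    simp
    ring
  · rw [← Real.rpow_natCast _ j, Real.rpow_def_of_pos (by positivity),
      Real.log_div (by positivity) (by positivity), Real.log_mul hx.ne' h1v.ne',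
      Real.log_mul h1x.ne' hv.ne', hj]
    congr 1
    ring

/-- Chernoff's bound for the lower tail, at a parameter `v` not above the true one. -/
lemma BernoulliOutcomes.measure_sum_eq_mul_exp_le (hX : BernoulliOutcomes P θ X) {d : V}
    (hθ : θ d ∈ Set.Icc (0 : ℝ) 1) {x v : ℝ} (hx : 0 ≤ x) (hxv : x ≤ v) (hv : 0 < v) (hv1 : v < 1)
    (hvθ : v ≤ θ d) {t j : ℕ} (hj : (j : ℝ) = t * x) :
    P.real {ω | ∑ i ∈ Finset.range t, X d i ω = j} * Real.exp (t * klReal x v) ≤ 1 := by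
  have h1x : 0 < 1 - x := by linarith
  have h1v : 0 < 1 - v := by linarith
  set a := x * (1 - v) / ((1 - x) * v) with ha
  have ha0 : 0 ≤ a := by positivity
  have ha1 : a ≤ 1 := by
    rw [ha, div_le_one (by positivity)]
    nlinarith
  have hB : 1 - v + v * a = (1 - v) / (1 - x) := by
    rw [ha]
    field_simp
    ring
  have h1 := hX.measure_sum_eq_mul_pow_le hθ t j ha0
  -- Since `a ≤ 1`, the one-step moment decreases in the parameter, so `θ d` may be replaced by the
  -- smaller `v`.
  have h2 : (1 - θ d + θ d * a) ^ t ≤ ((1 - v) / (1 - x)) ^ t := by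
    rw [← hB]
    exact pow_le_pow_left₀ (by nlinarith [hθ.1, hθ.2]) (by nlinarith) t
  rw [ha, ← exp_mul_klReal_mul_pow hx (by linarith) hv hv1 hj, ← mul_assoc] at h1
  exact le_of_mul_le_mul_right (by linarith [h1.trans h2])
    (pow_pos (div_pos h1v h1x) t)

/-- The exponential of the weighted divergence from a level below the true mean is bounded,
uniformly in the number of selections, by an integrable random variable. -/
lemma BernoulliOutcomes.exists_exp_klReal_bound (hX : BernoulliOutcomes P θ X) {d : V}
    (hθ : θ d ∈ Set.Icc (0 : ℝ) 1) {q : ℝ} (hq : 0 < q) (hqθ : q < θ d) :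
    ∃ H : Ω → ℝ, Integrable H P ∧ (∀ ω, 0 ≤ H ω) ∧ ∀ᵐ ω ∂P, ∀ t : ℕ,
      freq (fun d i => X d i ω) d t < q →
        Real.exp (t * klReal (freq (fun d i => X d i ω) d t) q) ≤ H ω := by
  classical
  -- Chernoff's bound is used at a level `v` strictly between `q` and the mean. By superadditivity
  -- of the divergence the exponential moment at `q` then decays like `exp (-κ * t)`, which beats
  -- the at most `t + 1` values of the sum.
  set v := (q + θ d) / 2 with hv
  have hqv : q < v := by linarith
  have hvθ : v < θ d := by linarith
  have hv1 : v < 1 := by linarith [hθ.2]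
  have hκ := klReal_pos hq.le hqv hv1
  set κ := klReal q v with hκdef
  set F : ℕ → ℕ → Set Ω := fun t j => {ω | ∑ i ∈ Finset.range t, X d i ω = j} with hF
  have hmF : ∀ t j, MeasurableSet (F t j) := fun t j =>
    (Finset.measurable_fun_sum _ fun i _ => hX.measurable d i) (measurableSet_singleton (j : ℝ))
  set J : ℕ → Finset ℕ := fun t => (Finset.range (t + 1)).filter fun j => (j : ℝ) / t < q with hJ
  have hterm : ∀ t, ∀ j ∈ J t,
      Real.exp (t * klReal ((j : ℝ) / t) q) * P.real (F t j) ≤ Real.exp (-κ) ^ t := by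
    intro t j hjt
    rw [hJ, Finset.mem_filter, Finset.mem_range] at hjt
    have hx0 : (0 : ℝ) ≤ (j : ℝ) / t := by positivity
    have hjx : (j : ℝ) = t * ((j : ℝ) / t) := by
      rcases Nat.eq_zero_or_pos t with rfl | ht
      · have : j = 0 := by omega
        simp [this]
      · have : (t : ℝ) ≠ 0 := by exact_mod_cast ht.ne'
        field_simp
    have h1 := hX.measure_sum_eq_mul_exp_le hθ hx0 (by linarith) (by linarith) hv1 hvθ.le hjx
    have h2 := klReal_add_klReal_le hjt.2.le hq hqv.le hv1
    have h3 : Real.exp (t * klReal ((j : ℝ) / t) q) ≤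
        Real.exp (t * klReal ((j : ℝ) / t) v) * Real.exp (-κ) ^ t := by
      rw [← Real.exp_nat_mul, ← Real.exp_add]
      apply Real.exp_le_exp.2
      nlinarith [Nat.cast_nonneg (α := ℝ) t]
    calc _ ≤ Real.exp (t * klReal ((j : ℝ) / t) v) * Real.exp (-κ) ^ t * P.real (F t j) :=
          mul_le_mul_of_nonneg_right h3 measureReal_nonneg
      _ = (P.real (F t j) * Real.exp (t * klReal ((j : ℝ) / t) v)) * Real.exp (-κ) ^ t := by ring
      _ ≤ 1 * Real.exp (-κ) ^ t := mul_le_mul_of_nonneg_right h1 (by positivity)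
      _ = _ := one_mul _
  have hr : ‖Real.exp (-κ)‖ < 1 := by
    rw [Real.norm_eq_abs, Real.abs_exp, Real.exp_lt_one_iff]
    linarith
  have hsum : Summable fun t : ℕ => ((t : ℝ) + 1) * Real.exp (-κ) ^ t := by
    have h1 := summable_pow_mul_geometric_of_norm_lt_one 1 hr
    have h2 := summable_pow_mul_geometric_of_norm_lt_one 0 hr
    simpa [add_mul] using h1.add h2
  obtain ⟨H, hHi, hH0, hH⟩ := exists_integrable_bound (P := P)
    (f := fun t ω => ∑ j ∈ J t, (F t j).indicator
      (fun _ => ENNReal.ofReal (Real.exp (t * klReal ((j : ℝ) / t) q))) ω)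
    (fun t => Finset.measurable_fun_sum _ fun j _ => measurable_const.indicator (hmF t j)) hsum
    (fun t => by
      rw [lintegral_finsetSum _ fun j _ => measurable_const.indicator (hmF t j)]
      have h1 : ∀ j ∈ J t, ∫⁻ ω, (F t j).indicator
          (fun _ => ENNReal.ofReal (Real.exp (t * klReal ((j : ℝ) / t) q))) ω ∂P ≤
          ENNReal.ofReal (Real.exp (-κ) ^ t) := by
        intro j hj
        rw [lintegral_indicator_const (hmF t j), ← ofReal_measureReal (measure_ne_top P _),
          ← ENNReal.ofReal_mul (by positivity)]
        exact ENNReal.ofReal_le_ofReal (hterm t j hj)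
      refine (Finset.sum_le_card_nsmul _ _ _ h1).trans ?_
      have h2 : (J t).card ≤ t + 1 := (Finset.card_filter_le _ _).trans (by simp)
      rw [nsmul_eq_mul, ENNReal.ofReal_mul (by positivity)]
      gcongr
      rw [← ENNReal.ofReal_natCast]
      exact ENNReal.ofReal_le_ofReal (by exact_mod_cast h2))
  refine ⟨H, hHi, hH0, ?_⟩
  filter_upwards [hH] with ω hω t ht
  set j := ((Finset.range t).filter fun i => X d i ω = 1).card with hjdef
  have hSj : ∑ i ∈ Finset.range t, X d i ω = j := by
    rw [hjdef, Finset.card_filter]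
    push_cast
    refine Finset.sum_congr rfl fun i _ => ?_
    rcases hX.binary d i ω with h | h <;> simp [h]
  have hfreq : freq (fun d i => X d i ω) d t = (j : ℝ) / t := by rw [freq, hSj]
  have hjt : j ≤ t := by simpa [hjdef] using Finset.card_filter_le (Finset.range t) fun i => X d i ω = 1
  have hjJ : j ∈ J t := by
    rw [hJ, Finset.mem_filter, Finset.mem_range]
    exact ⟨by omega, by rw [← hfreq]; exact ht⟩
  have h1 := (Finset.single_le_sum (f := fun j => (F t j).indicator
    (fun _ => ENNReal.ofReal (Real.exp (t * klReal ((j : ℝ) / t) q))) ω)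
    (fun _ _ => zero_le) hjJ).trans (hω t)
  have hmem : ω ∈ F t j := hSj
  simp only [Set.indicator_of_mem hmem] at h1
  rw [ENNReal.ofReal_le_ofReal_iff (hH0 ω)] at h1
  rwa [hfreq]

end Probability

/-! ### Deterministic bounds along a trajectory -/

/-- If the frequency is at least `q`, the index already dominates the empirical mean. Otherwise the
exponential bound places `q` under `log l`; the iterated logarithm only has to be nonnegative,
whence `3 ≤ l`. -/
lemma le_klIndex_of_exp_le {c R x q : ℝ} {t l : ℕ} (hc : 0 ≤ c) (hR : 0 < R)
    (hx : x ∈ Set.Icc (0 : ℝ) 1) (hq0 : 0 < q) (hq1 : q < 1) (hl : 3 ≤ l)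
    (h : x < q → Real.exp (t * klReal x q) ≤ l) : R * q ≤ klIndex c R (R * x) t l := by
  have hl3 : (3 : ℝ) ≤ l := by exact_mod_cast hl
  have h1 : 1 ≤ Real.log l := by
    rw [Real.le_log_iff_exp_le (by linarith)]
    linarith [Real.exp_one_lt_d9]
  have h2 : 0 ≤ c * Real.log (Real.log l) := mul_nonneg hc (Real.log_nonneg h1)
  rcases lt_or_ge x q with hxq | hxq
  · apply le_klIndex_of_klReal_le hR hq0 hq1 (by omega) (by linarith)
    have h3 := (Real.le_log_iff_exp_le (by linarith)).2 (h hxq)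
    linarith
  · have h3 := self_le_klIndex (c := c) (t := t) (l := l) (μ := R * x) (R := R)
      ⟨by nlinarith [hx.1], by nlinarith [hx.2]⟩ (by omega) (by linarith)
    nlinarith

lemma log_add_loglog_mono {c : ℝ} (hc : 0 ≤ c) {l l' : ℕ} (hl : 2 ≤ l) (hll : l ≤ l') :
    Real.log l + c * Real.log (Real.log l) ≤ Real.log l' + c * Real.log (Real.log l') := by
  have h0 : (1 : ℝ) < l := by exact_mod_cast (by omega : 1 < l)
  have h1 : Real.log l ≤ Real.log l' :=
    Real.log_le_log (by linarith) (by exact_mod_cast hll)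
  have h2 := Real.log_le_log (Real.log_pos h0) h1
  have h3 := mul_le_mul_of_nonneg_left h2 hc
  linarith

lemma eventually_log_add_loglog_lt {c κ : ℝ} (hc : 0 ≤ c) (hκ : 0 < κ) :
    ∀ᶠ s : ℕ in atTop, Real.log s + c * Real.log (Real.log s) < κ * s := by
  have h1 := (Real.isLittleO_log_id_atTop.comp_tendsto
    (tendsto_natCast_atTop_atTop (R := ℝ))).def (show 0 < κ / (2 * (1 + c)) by positivity)
  have h2 : ∀ᶠ s : ℕ in atTop, 1 ≤ Real.log (s : ℝ) :=
    (Real.tendsto_log_atTop.comp tendsto_natCast_atTop_atTop).eventually_ge_atTop _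
  filter_upwards [h1, h2, eventually_ge_atTop 1] with s h1 h2 h3
  have hs : (1 : ℝ) ≤ s := by exact_mod_cast h3
  simp only [Function.comp_apply, id_eq, Real.norm_eq_abs] at h1
  rw [abs_of_pos (by linarith), abs_of_pos (by linarith), div_mul_eq_mul_div,
    le_div_iff₀ (by positivity)] at h1
  have h4 : Real.log (Real.log s) ≤ Real.log s :=
    (Real.log_le_sub_one_of_pos (by linarith)).trans (by linarith)
  have h5 := mul_le_mul_of_nonneg_left h4 hc
  have : 0 < κ * s := by positivity
  linarith

lemma exists_uniform_gap {V : Type*} [Finite V] (μ : V → ℝ) (k : V) :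
    ∃ δ, 0 < δ ∧ ∀ d, μ k < μ d → μ k + 4 * δ ≤ μ d := by
  have h : ∀ᶠ δ in nhdsWithin (0 : ℝ) (Set.Ioi 0), ∀ d, μ k < μ d → μ k + 4 * δ ≤ μ d := by
    rw [eventually_all]
    intro d
    by_cases hd : μ k < μ d
    · have : ∀ᶠ δ in nhds (0 : ℝ), δ < (μ d - μ k) / 4 := gt_mem_nhds (by linarith)
      filter_upwards [nhdsWithin_le_nhds this] with δ hδ _
      linarith
    · exact Eventually.of_forall fun δ h => absurd h hd
  obtain ⟨δ, h1, h2⟩ := ((eventually_mem_nhdsWithin : ∀ᶠ δ in nhdsWithin (0 : ℝ) (Set.Ioi 0),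
    δ ∈ Set.Ioi (0 : ℝ)).and h).exists
  exact ⟨δ, h1, h2⟩

section Trajectory

variable {V : Type*} [DecidableEq V] [Fintype V] {G : SimpleGraph V} {ρ θ : V → ℝ} {c : ℝ} {p : ℕ}

/-- If the leadership count of `k` is large, then some decision that is already well explored was
selected, by comparison of indices, at a late slot of leader `k`. -/
lemma exists_explored_indexSlot {p : ℕ} (hp : 2 ≤ p) (dec lead : ℕ → V) (k : V) (n : ℕ)
    (hs : 4 * (2 * (Fintype.card V : ℝ) + 1) < countBefore lead k n) :
    ∃ m ∈ indexSlots p lead k n, (countBefore lead k n : ℝ) / 8 ≤ countBefore lead k m ∧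
      1 / (8 * Fintype.card V * p) * (countBefore lead k n : ℝ) ≤
        countBefore dec (dec m) m := by
  set s := countBefore lead k n with hsdef
  -- Without such a slot, poorly explored selections, early leaderships and forced slots would cover
  -- at most `1/16 + 1/8 + 1/2` of the `s` leaderships, up to constants.
  set e : ℝ := 1 / (8 * Fintype.card V * p) with he
  have hD : (0 : ℝ) < Fintype.card V := by exact_mod_cast Fintype.card_pos_iff.2 ⟨k⟩
  have hp2 : (2 : ℝ) ≤ p := by exact_mod_cast hp
  have he0 : 0 ≤ e := by positivity
  by_contra! hcon
  set Q := (indexSlots p lead k n).filter fun m => (s : ℝ) / 8 ≤ countBefore lead k m with hQ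
  have h1 : (Q.card : ℝ) ≤ Fintype.card V * (e * s + 1) := by
    have h := Finset.card_eq_sum_card_fiberwise (f := dec) (s := Q) (t := Finset.univ)
      (fun _ _ => Finset.mem_coe.2 (Finset.mem_univ _))
    rw [h]
    push_cast
    refine (Finset.sum_le_card_nsmul _ _ (e * s + 1) fun d _ => ?_).trans
      (by rw [nsmul_eq_mul, Finset.card_univ])
    refine card_le_of_countBefore_le (u := dec) (d := d) (by positivity)
      (fun m hm => (Finset.mem_filter.1 hm).2) fun m hm => ?_
    rw [Finset.mem_filter, hQ, Finset.mem_filter] at hm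
    have := hcon m hm.1.1 hm.1.2
    rw [hm.2] at this
    exact this.le
  have h2 : (((indexSlots p lead k n).filter fun m => ¬ (s : ℝ) / 8 ≤ countBefore lead k m).card :
      ℝ) ≤ s / 8 + 1 := by
    refine card_le_of_countBefore_le (u := lead) (d := k) (by positivity)
      (fun m hm => (mem_indexSlots.1 (Finset.mem_filter.1 hm).1).2.1) fun m hm => ?_
    exact (not_le.1 (Finset.mem_filter.1 hm).2).le
  have h3 : (Q.card : ℝ) +
      ((indexSlots p lead k n).filter fun m => ¬ (s : ℝ) / 8 ≤ countBefore lead k m).card =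
      (indexSlots p lead k n).card := by
    exact_mod_cast Finset.card_filter_add_card_filter_not _
  have h4 : (s : ℝ) ≤ (indexSlots p lead k n).card + Fintype.card V + s / 2 := by
    have h := countBefore_le_card_indexSlots (lead := lead) hp k n
    have h5 : (s : ℝ) ≤ (indexSlots p lead k n).card + Fintype.card V + ((s / 2 : ℕ) : ℝ) := by
      exact_mod_cast h
    have h6 : ((s / 2 : ℕ) : ℝ) ≤ s / 2 := Nat.cast_div_le
    linarith
  have h5 : Fintype.card V * e ≤ 1 / 16 := by
    rw [he, mul_one_div, div_le_div_iff₀ (by positivity) (by norm_num)]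
    nlinarith
  have h6 : Fintype.card V * e * s ≤ 1 / 16 * s := mul_le_mul_of_nonneg_right h5 (by positivity)
  have h7 : (0 : ℝ) ≤ s := by positivity
  nlinarith

/-- A decision with a better neighbour is the leader a bounded number of times, the bound being
linear in the concentration times of the empirical frequencies. -/
lemma exists_leadership_bound (hρ : ∀ d, 0 < ρ d) (hθ : ∀ d, θ d ∈ Set.Icc (0 : ℝ) 1) (hc : 0 < c)
    (hp : 2 ≤ p) {k k' : V} (hadj : G.Adj k k') (hlt : ρ k * θ k < ρ k' * θ k') :
    ∃ q C : ℝ, 0 < q ∧ q < θ k' ∧ 0 ≤ C ∧ ∀ (x : V → ℕ → ℝ) (dec lead : ℕ → V),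
      IsTrajectory G ρ c p x dec lead → (∀ d i, x d i = 0 ∨ x d i = 1) → ∀ A H : ℝ, 1 ≤ A → 0 ≤ H →
      (∀ (d : V) (t : ℕ), A ≤ t → |freq x d t - θ d| ≤ (t : ℝ) ^ (-(1 / 4) : ℝ)) →
      (∀ t : ℕ, freq x k' t < q → Real.exp (t * klReal (freq x k' t) q) ≤ H) →
      ∀ T, (countBefore lead k T : ℝ) ≤ C * (A + H) := by
  obtain ⟨δ, hδ, hgap⟩ := exists_uniform_gap (fun d => ρ d * θ d) k
  have hμk : 0 ≤ ρ k * θ k := mul_nonneg (hρ k).le (hθ k).1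
  -- With gaps at least `4 * δ`, the reward level of `q` exceeds that of `k` by `3 * δ` and stays
  -- below that of `k'`. The level `2 * δ` will separate it from empirical means, accurate to `δ`.
  set q := (ρ k * θ k + 3 * δ) / ρ k' with hq
  have hρq : ρ k' * q = ρ k * θ k + 3 * δ := mul_div_cancel₀ _ (hρ k').ne'
  have hq0 : 0 < q := div_pos (by linarith) (hρ k')
  have hqθ : q < θ k' := by
    rw [hq, div_lt_iff₀ (hρ k')]
    have := hgap k' hlt
    linarith
  set R := ∑ d, ρ d with hR
  have hρR : ∀ d, ρ d ≤ R := fun d =>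
    Finset.single_le_sum (fun d _ => (hρ d).le) (Finset.mem_univ d)
  have hR0 : 0 < R := (hρ k).trans_le (hρR k)
  have hD : (1 : ℝ) ≤ Fintype.card V := by exact_mod_cast Fintype.card_pos_iff.2 ⟨k⟩
  have hp2 : (2 : ℝ) ≤ p := by exact_mod_cast hp
  obtain ⟨w, hw⟩ : ∃ w : ℝ, w = 8 * Fintype.card V * p := ⟨_, rfl⟩
  have hw8 : 8 ≤ w := by rw [hw]; nlinarith
  have hwp : 2 * p ≤ w := by rw [hw]; nlinarith
  clear_value q R
  obtain ⟨t₀, ht₀⟩ := eventually_atTop.1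
    ((tendsto_mul_natCast_rpow_neg R).eventually (gt_mem_nhds hδ))
  obtain ⟨s₀, hs₀⟩ := eventually_atTop.1
    (eventually_log_add_loglog_lt hc.le (show 0 < 1 / w * (δ / R) ^ 2 by positivity))
  obtain ⟨b, hb⟩ : ∃ b : ℝ, b = s₀ + 2 * p * (Fintype.card V + 1) +
    4 * (2 * Fintype.card V + 1) + 24 + t₀ * w := ⟨_, rfl⟩
  have hb1 : (s₀ : ℝ) ≤ b ∧ 2 * p * (Fintype.card V + 1) ≤ b ∧
      4 * (2 * (Fintype.card V : ℝ) + 1) < b ∧ 24 ≤ b ∧ t₀ * w ≤ b := by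
    have h1 : (0 : ℝ) ≤ s₀ := by positivity
    have h2 : (0 : ℝ) ≤ 2 * p * (Fintype.card V + 1) := by positivity
    have h3 : 0 ≤ t₀ * w := by positivity
    subst hb
    refine ⟨?_, ?_, ?_, ?_, ?_⟩ <;> linarith
  refine ⟨q, b + w + 1, hq0, hqθ, by linarith, ?_⟩
  intro x dec lead htr hbin A H hA hH hconc hexp T
  by_contra! hcon
  have hAH : b + w + 1 + w * H ≤ (b + w + 1) * (A + H) := by
    have h1 : 0 ≤ (b + w + 1) * (A - 1) := mul_nonneg (by linarith) (by linarith)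
    have h2 : 0 ≤ (b + 1) * H := mul_nonneg (by linarith) hH
    linarith
  have hAH' : w * A + 1 ≤ (b + w + 1) * (A + H) := by
    have h1 : 0 ≤ (b + 1) * (A - 1) := mul_nonneg (by linarith) (by linarith)
    have h2 : 0 ≤ (b + w + 1) * H := mul_nonneg (by linarith) hH
    linarith
  have hwH : 0 ≤ w * H := by positivity
  -- a slot of leader `k` with a large leadership count
  have hpos : 1 ≤ countBefore lead k T := by
    have : (0 : ℝ) < countBefore lead k T := by linarith
    exact_mod_cast this
  -- The argument is moved to the last slot at which `k` leads, because the comparison of empirical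
  -- means needs `k` to be leader there; this costs one unit of the count.
  obtain ⟨n, -, hleadn, hcount⟩ := exists_countBefore_eq (u := lead) (d := k) (n := T)
    (v := countBefore lead k T - 1) (by omega)
  obtain ⟨s, hs⟩ : ∃ s, s = countBefore lead k n := ⟨_, rfl⟩
  have hsT : (s : ℝ) + 1 = countBefore lead k T := by
    have : s + 1 = countBefore lead k T := by omega
    exact_mod_cast this
  have hsb : b ≤ s := by linarith
  have hs1 : s₀ ≤ s := by
    have : (s₀ : ℝ) ≤ s := by linarith
    exact_mod_cast this
  have hs2 : 2 * p * (Fintype.card V + 1) ≤ (s : ℝ) := by linarith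
  have hs3 : 4 * (2 * (Fintype.card V : ℝ) + 1) < s := by linarith
  have hs4 : (24 : ℝ) ≤ s := by linarith
  have hes : 1 / w * s = s / w := one_div_mul_eq_div _ _
  have hs5 : (t₀ : ℝ) ≤ 1 / w * s := by
    rw [hes, le_div_iff₀ (by linarith)]
    linarith
  have hs6 : A ≤ 1 / w * s := by
    rw [hes, le_div_iff₀ (by linarith)]
    linarith
  have hs7 : H ≤ s / 8 := by
    have := mul_le_mul_of_nonneg_right hw8 hH
    linarith
  have hclose : ∀ (d : V) (t : ℕ), 1 / w * s ≤ t → |ρ d * freq x d t - ρ d * θ d| < δ := by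
    intro d t ht
    rw [← mul_sub, abs_mul, abs_of_pos (hρ d)]
    have h1 := hconc d t (hs6.trans ht)
    have h2 := ht₀ t (by exact_mod_cast hs5.trans ht)
    have h3 : 0 ≤ (t : ℝ) ^ (-(1 / 4) : ℝ) := by positivity
    calc ρ d * |freq x d t - θ d| ≤ R * (t : ℝ) ^ (-(1 / 4) : ℝ) :=
          mul_le_mul (hρR d) h1 (abs_nonneg _) hR0.le
      _ < δ := h2
  obtain ⟨m, hm, hm8, hme⟩ := exists_explored_indexSlot hp dec lead k n (hs ▸ hs3)
  rw [← hs] at hm8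
  rw [← hs, ← hw] at hme
  obtain ⟨hmn, hleadm, hDm, hex⟩ := mem_indexSlots.1 hm
  have hd := hclose (dec m) _ hme
  rw [abs_lt] at hd
  -- A better selected decision would beat `k` at slot `n`, where both are well explored. A decision
  -- no better than `k` must have an index as large as that of `k'`, so its linear count contradicts
  -- the logarithmic threshold.
  rcases lt_or_ge (ρ k * θ k) (ρ (dec m) * θ (dec m)) with hcase | hcase
  · have hk := hclose k _ (le_trans (by
        rw [hes]
        exact div_le_div_of_nonneg_left (by positivity) (by positivity) hwp)
      (hs ▸ htr.le_countBefore_dec hp k n (hs ▸ hs2)))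
    have hd' := hclose (dec m) (countBefore dec (dec m) n)
      (hme.trans (by exact_mod_cast countBefore_mono dec (dec m) hmn.le))
    have hl := htr.leader n (dec m)
    rw [hleadn, empMean_eq, empMean_eq] at hl
    rw [abs_lt] at hk hd'
    have := hgap (dec m) hcase
    linarith [hk.2, hd'.1]
  · have hidx := htr.maxIndex m hDm (by rw [hleadm]; exact hex) k' (by rw [hleadm]; exact Or.inr hadj)
    rw [hleadm, empMean_eq, empMean_eq] at hidx
    have hl3 : 3 ≤ countBefore lead k m := by
      have : (3 : ℝ) ≤ countBefore lead k m := by linarith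
      exact_mod_cast this
    have hlow := le_klIndex_of_exp_le hc.le (hρ k') (freq_mem_Icc hbin k' (countBefore dec k' m))
      hq0 (hqθ.trans_le (hθ k').2) hl3 (fun h => (hexp _ h).trans (hs7.trans hm8))
    obtain ⟨v, hv⟩ : ∃ v, v = (ρ k * θ k + 2 * δ) / ρ (dec m) := ⟨_, rfl⟩
    have hρv : ρ (dec m) * v = ρ k * θ k + 2 * δ := by
      rw [hv]; exact mul_div_cancel₀ _ (hρ _).ne'
    have hv0 : 0 < v := by
      rw [hv]; exact div_pos (by linarith) (hρ _)
    set y := freq x (dec m) (countBefore dec (dec m) m) with hy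
    have hy0 : 0 ≤ y := (freq_mem_Icc hbin _ _).1
    have hyv : δ / R ≤ v - y := by
      have h1 : δ ≤ ρ (dec m) * (v - y) := by rw [mul_sub, hρv]; linarith [hd.2]
      have h2 : 0 ≤ v - y := by
        by_contra! h
        linarith [mul_neg_of_pos_of_neg (hρ (dec m)) h]
      rw [div_le_iff₀ hR0]
      linarith [mul_le_mul_of_nonneg_right (hρR (dec m)) h2]
    have hyv' : y ≤ v := by linarith [div_pos hδ hR0]
    obtain ⟨hv1, hbd⟩ := klReal_le_of_lt_klIndex (hρ (dec m)) hy0 hyv' hv0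
      (show ρ (dec m) * v < _ from (by rw [hρv]; linarith : _ < ρ k' * q).trans_le (hlow.trans hidx))
    have h1 := log_add_loglog_mono hc.le (by omega : 2 ≤ countBefore lead k m)
      (countBefore_mono lead k hmn.le)
    rw [← hs] at h1
    have h2 := hs₀ s hs1
    have h3 : (δ / R) ^ 2 ≤ klReal y v :=
      (pow_le_pow_left₀ (by positivity) hyv 2).trans (sq_sub_le_klReal hy0 hyv' hv0 hv1)
    have h4 : 1 / w * s * (δ / R) ^ 2 ≤ countBefore dec (dec m) m * klReal y v :=
      mul_le_mul hme h3 (by positivity) (by positivity)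
    rw [mul_right_comm] at h4
    linarith

/-- A suboptimal neighbour of the best decision is selected by comparison of indices, while the best
decision leads, at most about `rateCoeff * log T` times. -/
lemma exists_selection_bound (hρ : ∀ d, 0 < ρ d) (hθ : ∀ d, θ d ∈ Set.Icc (0 : ℝ) 1) (hc : 0 < c)
    (hp : 2 ≤ p) {k d : V} (hlt : ρ d * θ d < ρ k * θ k) {ε : ℝ} (hε : 0 < ε) :
    ∃ C : ℝ, 0 ≤ C ∧ ∀ (x : V → ℕ → ℝ) (dec lead : ℕ → V),
      IsTrajectory G ρ c p x dec lead → (∀ d i, x d i = 0 ∨ x d i = 1) → ∀ A : ℝ, 1 ≤ A →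
      (∀ (d : V) (t : ℕ), A ≤ t → |freq x d t - θ d| ≤ (t : ℝ) ^ (-(1 / 4) : ℝ)) →
      ∀ T : ℕ, 3 ≤ T → (((indexSlots p lead k T).filter fun m => dec m = d).card : ℝ) ≤
        rateCoeff (ρ d) (θ d) (ρ k * θ k) ε * (Real.log T + c * Real.log (Real.log T)) + C * A := by
  have hp2 : (2 : ℝ) ≤ p := by exact_mod_cast hp
  set a : ℝ := (1 / (2 * p)) ^ (-(1 / 4) : ℝ) with ha
  have ha0 : 0 < a := by positivity
  -- The leader has at least `s / (2 * p)` selections, so its error is at most `ρ k * a * s ^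
  -- (-1/4)`; the factor `2` makes the required inequality strict.
  obtain ⟨η, t₁, s₀, hη, hidx⟩ := exists_index_bound (hρ d) (hθ d).1 hlt hc hε (2 * ρ k * a)
    (by have := hρ k; positivity)
  obtain ⟨t₀, ht₀⟩ := eventually_atTop.1
    ((tendsto_mul_natCast_rpow_neg 1).eventually (gt_mem_nhds hη))
  obtain ⟨s₁, hs₁⟩ : ∃ s₁ : ℝ, s₁ = s₀ + 2 * p * (Fintype.card V + 1) + 3 := ⟨_, rfl⟩
  have hs₁0 : 0 ≤ s₁ := by rw [hs₁]; positivity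
  refine ⟨s₁ + 2 * p + 1 + (t₀ + 2) + (|t₁| + 1), by positivity, ?_⟩
  intro x dec lead htr hbin A hA hconc T hT
  set Q := (indexSlots p lead k T).filter fun m => dec m = d with hQ
  have hQmem : ∀ {m}, m ∈ Q → m ∈ indexSlots p lead k T ∧ dec m = d := fun hm =>
    Finset.mem_filter.1 hm
  -- Slots with few leaderships, slots with `d` poorly explored, and the rest, where both
  -- frequencies are accurate. The first two contribute only `O(A)`.
  set Q₁ := Q.filter fun m => (countBefore lead k m : ℝ) ≤ s₁ + 2 * p * A with hQ₁
  set Q₂ := Q.filter fun m => (countBefore dec d m : ℝ) ≤ A + t₀ with hQ₂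
  set Q₃ := Q.filter fun m => ¬ (countBefore lead k m : ℝ) ≤ s₁ + 2 * p * A ∧
    ¬ (countBefore dec d m : ℝ) ≤ A + t₀ with hQ₃
  have hL : 0 ≤ Real.log T + c * Real.log (Real.log T) := by
    have hT3 : (3 : ℝ) ≤ T := by exact_mod_cast hT
    have h1 : 1 ≤ Real.log T := by
      rw [Real.le_log_iff_exp_le (by linarith)]
      linarith [Real.exp_one_lt_d9]
    have := Real.log_nonneg h1
    positivity
  have hκ := rateCoeff_nonneg (ρ := ρ d) (θ := θ d) (μ := ρ k * θ k) hε
  have h1 : (Q₁.card : ℝ) ≤ s₁ + 2 * p * A + 1 :=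
    card_le_of_countBefore_le (u := lead) (d := k) (by positivity)
      (fun m hm => (mem_indexSlots.1 (hQmem (Finset.mem_filter.1 hm).1).1).2.1)
      fun m hm => (Finset.mem_filter.1 hm).2
  have h2 : (Q₂.card : ℝ) ≤ A + t₀ + 1 :=
    card_le_of_countBefore_le (u := dec) (d := d) (by positivity)
      (fun m hm => (hQmem (Finset.mem_filter.1 hm).1).2) fun m hm => (Finset.mem_filter.1 hm).2
  have h3 : (Q₃.card : ℝ) ≤ rateCoeff (ρ d) (θ d) (ρ k * θ k) ε *
      (Real.log T + c * Real.log (Real.log T)) + |t₁| + 1 := by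
    refine card_le_of_countBefore_le (u := dec) (d := d) (by positivity)
      (fun m hm => (hQmem (Finset.mem_filter.1 hm).1).2) fun m hm => ?_
    obtain ⟨hmQ, hm1, hm2⟩ := Finset.mem_filter.1 hm
    rw [not_le] at hm1 hm2
    obtain ⟨hmI, hdec⟩ := hQmem hmQ
    obtain ⟨hmT, hleadm, hDm, hex⟩ := mem_indexSlots.1 hmI
    obtain ⟨s, hs⟩ : ∃ s, s = countBefore lead k m := ⟨_, rfl⟩
    rw [← hs] at hm1
    have hpA : 0 ≤ 2 * p * A := by positivity
    have hpD : (0 : ℝ) ≤ 2 * p * (Fintype.card V + 1) := by positivity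
    have hs₀0 : (0 : ℝ) ≤ s₀ := by positivity
    have hss₀ : s₀ ≤ s := by
      have : (s₀ : ℝ) ≤ s := by linarith
      exact_mod_cast this
    have hs3 : 3 ≤ s := by
      have : (3 : ℝ) ≤ s := by linarith
      exact_mod_cast this
    have hs3' : (3 : ℝ) ≤ s := by exact_mod_cast hs3
    have htk := htr.le_countBefore_dec hp k m (by rw [← hs]; linarith)
    rw [← hs] at htk
    have hAs : A ≤ (s : ℝ) / (2 * p) := by
      rw [le_div_iff₀ (by positivity)]
      linarith
    have hck := hconc k _ (hAs.trans htk)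
    have hpow : (countBefore dec k m : ℝ) ^ (-(1 / 4) : ℝ) ≤ a * (s : ℝ) ^ (-(1 / 4) : ℝ) := by
      rw [ha, ← Real.mul_rpow (by positivity) (by positivity), one_div_mul_eq_div]
      exact Real.rpow_le_rpow_of_nonpos (by positivity) htk (by norm_num)
    have hcd := hconc d (countBefore dec d m) (by linarith [Nat.cast_nonneg (α := ℝ) t₀])
    have hη' := ht₀ (countBefore dec d m) (by
      have : (t₀ : ℝ) ≤ countBefore dec d m := by linarith
      exact_mod_cast this)
    rw [abs_le] at hck hcd
    have hmax := htr.maxIndex m hDm (by rw [hleadm]; exact hex) k (Or.inl hleadm.symm)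
    rw [hleadm, hdec, empMean_eq, empMean_eq, ← hs] at hmax
    have hlog : 0 ≤ Real.log s + c * Real.log (Real.log s) := by
      have h1 : 1 ≤ Real.log s := by
        rw [Real.le_log_iff_exp_le (by linarith)]
        linarith [Real.exp_one_lt_d9]
      have := Real.log_nonneg h1
      positivity
    have hf := freq_mem_Icc hbin k (countBefore dec k m)
    have hself := self_le_klIndex (c := c) (t := countBefore dec k m) (l := s)
      (μ := ρ k * freq x k (countBefore dec k m)) (R := ρ k)
      ⟨mul_nonneg (hρ k).le hf.1, mul_le_of_le_one_right (hρ k).le hf.2⟩ (by omega) hlog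
    have hbd := hidx s (countBefore dec d m) hss₀ (freq x d (countBefore dec d m))
      (freq_mem_Icc hbin _ _).1 (by linarith [hcd.2]) (by
        refine lt_of_lt_of_le ?_ (hself.trans hmax)
        have h4 : 0 < a * (s : ℝ) ^ (-(1 / 4) : ℝ) := by
          have : (0 : ℝ) < s := by linarith
          positivity
        have h5 : θ k - a * (s : ℝ) ^ (-(1 / 4) : ℝ) ≤ freq x k (countBefore dec k m) := by
          linarith [hck.1]
        have h6 := mul_le_mul_of_nonneg_left h5 (hρ k).le
        linarith [mul_pos (hρ k) h4])
    have hmono := log_add_loglog_mono hc.le (by omega : 2 ≤ s)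
      (hs.le.trans ((countBefore_le lead k m).trans hmT.le))
    have := mul_le_mul_of_nonneg_left hmono hκ
    linarith [le_abs_self t₁]
  have hcover : Q ⊆ Q₁ ∪ Q₂ ∪ Q₃ := by
    intro m hm
    simp only [hQ₁, hQ₂, hQ₃, Finset.mem_union, Finset.mem_filter, hm, true_and]
    tauto
  have h4 : (Q.card : ℝ) ≤ Q₁.card + Q₂.card + Q₃.card := by
    have h5 := (Finset.card_le_card hcover).trans (Finset.card_union_le _ _)
    have h6 := Finset.card_union_le Q₁ Q₂
    exact_mod_cast h5.trans (by omega)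
  linarith [mul_nonneg hs₁0 (sub_nonneg.2 hA), mul_nonneg (abs_nonneg t₁) (sub_nonneg.2 hA),
    mul_nonneg (Nat.cast_nonneg (α := ℝ) t₀) (sub_nonneg.2 hA)]

/-- Selections of a suboptimal decision, according to the leader at the time. -/
lemma IsTrajectory.countBefore_dec_le {x : V → ℕ → ℝ} {dec lead : ℕ → V}
    (h : IsTrajectory G ρ c p x dec lead) {k d : V} (hd : d ≠ k) (T : ℕ) :
    countBefore dec d T ≤ Fintype.card V + ∑ j ∈ Finset.univ.erase k, countBefore lead j T +
      ((indexSlots p lead k T).filter fun m => dec m = d).card := by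
  have hsub : (Finset.range T).filter (fun m => dec m = d) ⊆
      Finset.range (Fintype.card V) ∪
        (Finset.univ.erase k).biUnion (fun j => (Finset.range T).filter fun m => lead m = j) ∪
        (indexSlots p lead k T).filter fun m => dec m = d := by
    intro m hm
    rw [Finset.mem_filter, Finset.mem_range] at hm
    rw [Finset.mem_union, Finset.mem_union, Finset.mem_range, Finset.mem_filter, mem_indexSlots]
    rcases lt_or_ge m (Fintype.card V) with h1 | h1
    · exact Or.inl (Or.inl h1)
    · by_cases h2 : lead m = k
      · refine Or.inr ⟨⟨hm.1, h2, h1, fun h3 => hd ?_⟩, hm.2⟩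
        rw [← hm.2, h.exploit m h1 (by rw [h2]; exact h3), h2]
      · refine Or.inl (Or.inr ?_)
        rw [Finset.mem_biUnion]
        exact ⟨lead m, by simp [h2], by simp [hm.1]⟩
  have h1 := Finset.card_le_card hsub
  have h2 := Finset.card_union_le (Finset.range (Fintype.card V) ∪
    (Finset.univ.erase k).biUnion (fun j => (Finset.range T).filter fun m => lead m = j))
    ((indexSlots p lead k T).filter fun m => dec m = d)
  have h3 := Finset.card_union_le (Finset.range (Fintype.card V))
    ((Finset.univ.erase k).biUnion (fun j => (Finset.range T).filter fun m => lead m = j))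
  have h4 : ((Finset.univ.erase k).biUnion
      (fun j => (Finset.range T).filter fun m => lead m = j)).card ≤
      ∑ j ∈ Finset.univ.erase k, countBefore lead j T := Finset.card_biUnion_le
  rw [Finset.card_range] at h3
  change countBefore dec d T ≤ _ at h1
  omega

lemma IsTrajectory.filter_indexSlots_eq_empty {x : V → ℕ → ℝ} {dec lead : ℕ → V}
    (h : IsTrajectory G ρ c p x dec lead) {k d : V} (hd : d ≠ k) (hadj : ¬ G.Adj k d) (T : ℕ) :
    ((indexSlots p lead k T).filter fun m => dec m = d) = ∅ := by
  refine Finset.filter_false_of_mem fun m hm hdec => ?_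
  obtain ⟨-, hl, hD, hex⟩ := mem_indexSlots.1 hm
  have := h.near m hD (by rw [hl]; exact hex)
  rw [hl, hdec] at this
  tauto

end Trajectory

/-! ### Expected numbers of selections and regret -/

lemma GraphUnimodal.exists_better_neighbor {V : Type*} {G : SimpleGraph V} {ρ θ : V → ℝ} {dstar : V}
    (huni : GraphUnimodal G ρ θ) (hstar : IsBest ρ θ dstar) {k : V} (hk : k ≠ dstar) :
    ∃ k', G.Adj k k' ∧ ρ k * θ k < ρ k' * θ k' := by
  obtain ⟨-, d', hd', hpath⟩ := huni
  have hdd : d' = dstar := by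
    by_contra h
    exact lt_asymm (hstar d' h) (hd' dstar (Ne.symm h))
  obtain ⟨len, w, h0, hlen, hstep⟩ := hpath k
  have hpos : 0 < len := by
    rcases Nat.eq_zero_or_pos len with h | h
    · subst h
      exact absurd (h0.symm.trans (hlen.trans hdd)) hk
    · exact h
  have h1 := hstep 0 hpos
  rw [h0] at h1
  exact ⟨w (0 + 1), h1⟩

/-- The outcomes almost surely have all the concentration properties used along a trajectory. -/
lemma BernoulliOutcomes.exists_uniform_concentration {V Ω : Type*} [Fintype V]
    [MeasurableSpace Ω] {P : Measure Ω} [IsProbabilityMeasure P] {θ : V → ℝ} {X : V → ℕ → Ω → ℝ}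
    (hX : BernoulliOutcomes P θ X)
    (hθ : ∀ d, θ d ∈ Set.Icc (0 : ℝ) 1) :
    ∃ A : Ω → ℝ, Integrable A P ∧ (∀ ω, 1 ≤ A ω) ∧ ∀ᵐ ω ∂P, ∀ (d : V) (t : ℕ), A ω ≤ t →
      |freq (fun d i => X d i ω) d t - θ d| ≤ (t : ℝ) ^ (-(1 / 4) : ℝ) := by
  choose A hAi hA1 hA using fun d => hX.exists_concentration (hθ d).1
  refine ⟨fun ω => 1 + ∑ d, A d ω, (integrable_const 1).add (integrable_finsetSum _ fun d _ => hAi d),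
    fun ω => ?_, ?_⟩
  · have : 0 ≤ ∑ d, A d ω := Finset.sum_nonneg fun d _ => by linarith [hA1 d ω]
    linarith
  · filter_upwards [ae_all_iff.2 hA] with ω hω d t ht
    have h := Finset.single_le_sum (f := fun d => A d ω) (fun d _ => by linarith [hA1 d ω])
      (Finset.mem_univ d)
    exact hω d t (by linarith)

lemma integrable_countBefore {V Ω : Type*} [DecidableEq V] [MeasurableSpace V]
    [MeasurableSingletonClass V] [MeasurableSpace Ω] {P : Measure Ω} [IsProbabilityMeasure P]
    {dec : ℕ → Ω → V} (hdec : ∀ n, Measurable (dec n)) (d : V) (T : ℕ) :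
    Integrable (fun ω => (countBefore (fun n => dec n ω) d T : ℝ)) P := by
  have hm : Measurable fun ω => (countBefore (fun n => dec n ω) d T : ℝ) := by
    induction T with
    | zero => simp [countBefore]
    | succ n ih =>
      simp only [countBefore_succ, Nat.cast_add, Nat.cast_ite]
      exact ih.add (Measurable.ite (hdec n (measurableSet_singleton d)) measurable_const
        measurable_const)
  refine Integrable.of_bound hm.aestronglyMeasurable (T : ℝ) (ae_of_all _ fun ω => ?_)
  rw [Real.norm_natCast]
  exact_mod_cast countBefore_le _ d T

section Regret

variable {V : Type*} [DecidableEq V] [Fintype V] {G : SimpleGraph V} {ρ θ : V → ℝ} {c : ℝ} {p : ℕ} {Ω : Type*} [MeasurableSpace Ω]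
  {P : Measure Ω} [IsProbabilityMeasure P] {X : V → ℕ → Ω → ℝ} {dec lead : ℕ → Ω → V}

lemma exists_integrable_leadership_bound {dstar : V} (hρ : ∀ d, 0 < ρ d)
    (huni : GraphUnimodal G ρ θ) (hstar : IsBest ρ θ dstar) (hc : 0 < c) (hp : 2 ≤ p)
    (hX : BernoulliOutcomes P θ X)
    (hrun : ∀ ω, IsTrajectory G ρ c p (fun d i => X d i ω) (fun n => dec n ω) (fun n => lead n ω))
    {k : V} (hk : k ≠ dstar) :
    ∃ B : Ω → ℝ, Integrable B P ∧ ∀ᵐ ω ∂P, ∀ T,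
      (countBefore (fun n => lead n ω) k T : ℝ) ≤ B ω := by
  obtain ⟨k', hadj, hlt⟩ := huni.exists_better_neighbor hstar hk
  obtain ⟨q, C, hq, hqθ, -, hbound⟩ := exists_leadership_bound hρ huni.1 hc hp hadj hlt
  obtain ⟨A, hAi, hA1, hA⟩ := hX.exists_uniform_concentration huni.1
  obtain ⟨H, hHi, hH0, hH⟩ := hX.exists_exp_klReal_bound (huni.1 k') hq hqθ
  refine ⟨fun ω => C * (A ω + H ω), (hAi.add hHi).const_mul C, ?_⟩
  filter_upwards [hA, hH] with ω h1 h2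
  exact hbound _ _ _ (hrun ω) (fun d i => hX.binary d i ω) (A ω) (H ω) (hA1 ω) (hH0 ω) h1 h2

variable [MeasurableSpace V] [MeasurableSingletonClass V]

lemma regret_eq_sum (hdec : ∀ n, Measurable (dec n)) (dstar : V) (T : ℕ) :
    regret P ρ θ dstar dec T = ∑ d, (ρ dstar * θ dstar - ρ d * θ d) *
      ∫ ω, (countBefore (fun n => dec n ω) d T : ℝ) ∂P := by
  have h : ∑ d, ∫ ω, (countBefore (fun n => dec n ω) d T : ℝ) ∂P = T := by
    rw [← integral_finsetSum _ fun d _ => integrable_countBefore hdec d T]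
    have h1 : ∀ ω, ∑ d, (countBefore (fun n => dec n ω) d T : ℝ) = T := fun ω => by
      exact_mod_cast sum_countBefore (fun n => dec n ω) T
    simp [h1]
  rw [regret]
  nth_rewrite 1 [← h]
  rw [Finset.mul_sum, ← Finset.sum_sub_distrib]
  exact Finset.sum_congr rfl fun d _ => by ring

/-- Leaderships of other decisions and concentration times enter only through the integrable `F`,
free of `T`, so after integration they contribute a constant. -/
lemma exists_expected_selections_bound {dstar : V} (hρ : ∀ d, 0 < ρ d)
    (huni : GraphUnimodal G ρ θ) (hstar : IsBest ρ θ dstar) (hc : 0 < c) (hp : 2 ≤ p)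
    (hX : BernoulliOutcomes P θ X)
    (hrun : ∀ ω, IsTrajectory G ρ c p (fun d i => X d i ω) (fun n => dec n ω) (fun n => lead n ω))
    (hdec : ∀ n, Measurable (dec n)) {d : V} (hd : d ≠ dstar)
    {ε : ℝ} (hε : 0 < ε) :
    ∃ C : ℝ, ∀ T : ℕ, 3 ≤ T → ∫ ω, (countBefore (fun n => dec n ω) d T : ℝ) ∂P ≤
      (open Classical in if G.Adj dstar d then
        rateCoeff (ρ d) (θ d) (ρ dstar * θ dstar) ε else 0) *
          (Real.log T + c * Real.log (Real.log T)) + C := by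
  classical
  obtain ⟨A, hAi, hA1, hA⟩ := hX.exists_uniform_concentration huni.1
  obtain ⟨C, hC, hbound⟩ := exists_selection_bound (G := G) hρ huni.1 hc hp (hstar d hd) hε
  have hlead : ∀ k : V, ∃ B : Ω → ℝ, Integrable B P ∧ (k ≠ dstar → ∀ᵐ ω ∂P, ∀ T,
      (countBefore (fun n => lead n ω) k T : ℝ) ≤ B ω) := by
    intro k
    by_cases hk : k = dstar
    · exact ⟨0, integrable_zero _ _ _, fun h => absurd hk h⟩
    · obtain ⟨B, h1, h2⟩ := exists_integrable_leadership_bound hρ huni hstar hc hp hX hrun hk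
      exact ⟨B, h1, fun _ => h2⟩
  choose B hBi hB using hlead
  set F : Ω → ℝ := fun ω => Fintype.card V + ∑ k ∈ Finset.univ.erase dstar, B k ω + C * A ω with hF
  have hFi : Integrable F P := ((integrable_const _).add
    (integrable_finsetSum _ fun k _ => hBi k)).add (hAi.const_mul C)
  refine ⟨∫ ω, F ω ∂P, fun T hT => ?_⟩
  set κ := (if G.Adj dstar d then rateCoeff (ρ d) (θ d) (ρ dstar * θ dstar) ε else 0) *
    (Real.log T + c * Real.log (Real.log T)) with hκ
  have hpt : ∀ᵐ ω ∂P, (countBefore (fun n => dec n ω) d T : ℝ) ≤ κ + F ω := by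
    have hB' : ∀ᵐ ω ∂P, ∀ k, k ≠ dstar → ∀ T,
        (countBefore (fun n => lead n ω) k T : ℝ) ≤ B k ω := by
      rw [ae_all_iff]
      intro k
      by_cases hk : k = dstar
      · exact ae_of_all _ fun ω h => absurd hk h
      · filter_upwards [hB k hk] with ω hω _ using hω
    filter_upwards [hA, hB'] with ω h1 h2
    have h3 := (hrun ω).countBefore_dec_le hd T
    have h3' : (countBefore (fun n => dec n ω) d T : ℝ) ≤ Fintype.card V +
        ∑ k ∈ Finset.univ.erase dstar, (countBefore (fun n => lead n ω) k T : ℝ) +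
        ((indexSlots p (fun n => lead n ω) dstar T).filter fun m => dec m ω = d).card := by
      exact_mod_cast h3
    have h4 : ∑ k ∈ Finset.univ.erase dstar, (countBefore (fun n => lead n ω) k T : ℝ) ≤
        ∑ k ∈ Finset.univ.erase dstar, B k ω :=
      Finset.sum_le_sum fun k hk => h2 k (Finset.ne_of_mem_erase hk) T
    have h5 : (((indexSlots p (fun n => lead n ω) dstar T).filter fun m => dec m ω = d).card : ℝ) ≤
        κ + C * A ω := by
      by_cases hadj : G.Adj dstar d
      · rw [hκ, if_pos hadj]
        exact hbound _ _ _ (hrun ω) (fun d i => hX.binary d i ω) (A ω) (hA1 ω) h1 T hT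
      · rw [hκ, if_neg hadj, (hrun ω).filter_indexSlots_eq_empty hd hadj]
        have := mul_nonneg hC (zero_le_one.trans (hA1 ω))
        simpa using this
    simp only [hF]
    linarith
  have h := integral_mono_ae (g := fun ω => κ + F ω) (integrable_countBefore hdec d T)
    ((integrable_const κ).add hFi) hpt
  refine h.trans (le_of_eq ?_)
  rw [integral_add (integrable_const κ) hFi]
  simp

lemma exists_regret_bound {dstar : V} (hρ : ∀ d, 0 < ρ d)
    (huni : GraphUnimodal G ρ θ) (hstar : IsBest ρ θ dstar) (hc : 0 < c) (hp : 2 ≤ p)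
    (hX : BernoulliOutcomes P θ X)
    (hrun : ∀ ω, IsTrajectory G ρ c p (fun d i => X d i ω) (fun n => dec n ω) (fun n => lead n ω))
    (hdec : ∀ n, Measurable (dec n)) {ε : ℝ} (hε : 0 < ε) :
    ∃ C : ℝ, ∀ T : ℕ, 3 ≤ T → regret P ρ θ dstar dec T ≤
      (1 + ε) * cG G ρ θ dstar * (Real.log T + c * Real.log (Real.log T)) + C := by
  classical
  have hex : ∀ d, ∃ C : ℝ, ∀ T : ℕ, 3 ≤ T →
      (ρ dstar * θ dstar - ρ d * θ d) * ∫ ω, (countBefore (fun n => dec n ω) d T : ℝ) ∂P ≤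
      (if G.Adj dstar d ∧ ρ dstar * θ dstar ≤ ρ d then (ρ dstar * θ dstar - ρ d * θ d) *
        ((klBernoulli (θ d) (ρ dstar * θ dstar / ρ d))⁻¹).toReal else 0) *
        ((1 + ε) * (Real.log T + c * Real.log (Real.log T))) + C := by
    intro d
    by_cases hd : d = dstar
    · subst hd
      exact ⟨0, fun T _ => by simp⟩
    · obtain ⟨C, hC⟩ := exists_expected_selections_bound hρ huni hstar hc hp hX hrun hdec hd hε
      refine ⟨(ρ dstar * θ dstar - ρ d * θ d) * C, fun T hT => ?_⟩
      have h1 := mul_le_mul_of_nonneg_left (hC T hT) (sub_nonneg.2 (hstar d hd).le)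
      refine h1.trans (le_of_eq ?_)
      by_cases h2 : G.Adj dstar d
      · by_cases h3 : ρ dstar * θ dstar ≤ ρ d
        · rw [if_pos h2, if_pos ⟨h2, h3⟩, rateCoeff, if_pos h3]
          ring
        · rw [if_pos h2, if_neg (fun h => h3 h.2), rateCoeff, if_neg h3]
          ring
      · rw [if_neg h2, if_neg (fun h => h2 h.1)]
        ring
  choose C hC using hex
  refine ⟨∑ d, C d, fun T hT => ?_⟩
  rw [regret_eq_sum hdec]
  refine (Finset.sum_le_sum fun d _ => hC d T hT).trans (le_of_eq ?_)
  rw [Finset.sum_add_distrib, ← Finset.sum_mul, ← Finset.sum_filter]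
  unfold cG
  ring

end Regret

/-! ### Asymptotics -/

lemma isBigO_loglog_of_le {R : ℕ → ℝ} {a c C : ℝ} (hac : 0 ≤ a * c) (hC : ∀ T : ℕ, 3 ≤ T →
    R T ≤ a * (Real.log T + c * Real.log (Real.log T)) + C) :
    (fun T : ℕ => max 0 (R T - a * Real.log T)) =O[atTop]
      fun T : ℕ => Real.log (Real.log (T : ℝ)) := by
  have h1 : ∀ᶠ T : ℕ in atTop, 1 ≤ Real.log (Real.log (T : ℝ)) :=
    (Real.tendsto_log_atTop.comp (Real.tendsto_log_atTop.comp
      tendsto_natCast_atTop_atTop)).eventually_ge_atTop _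
  refine IsBigO.of_bound (a * c + |C|) ?_
  filter_upwards [h1, eventually_ge_atTop 3] with T h2 h3
  rw [Real.norm_of_nonneg (le_max_left _ _), Real.norm_of_nonneg (by linarith)]
  have h4 := mul_le_mul_of_nonneg_left h2 (abs_nonneg C)
  have h5 := mul_nonneg hac (by linarith : 0 ≤ Real.log (Real.log (T : ℝ)))
  have h6 := hC T h3
  have h7 := le_abs_self C
  have h8 := abs_nonneg C
  exact max_le (by linarith) (by linarith)

/-- The `log log` remainder vanishes after division by `log T`; then `ε` tends to `0`. Working in
`EReal` avoids any boundedness condition on the quotient. -/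
lemma limsup_div_log_le {R : ℕ → ℝ} {a : ℝ} (h : ∀ ε : ℝ, 0 < ε → ∃ f : ℕ → ℝ,
    f =O[atTop] (fun T : ℕ => Real.log (Real.log (T : ℝ))) ∧
      ∀ T : ℕ, R T ≤ (1 + ε) * a * Real.log T + f T) :
    limsup (fun T : ℕ => ((R T / Real.log T : ℝ) : EReal)) atTop ≤ (a : EReal) := by
  have hlog : Tendsto (fun T : ℕ => Real.log (T : ℝ)) atTop atTop :=
    Real.tendsto_log_atTop.comp tendsto_natCast_atTop_atTop
  have hε : ∀ ε : ℝ, 0 < ε →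
      limsup (fun T : ℕ => ((R T / Real.log T : ℝ) : EReal)) atTop ≤ (((1 + ε) * a : ℝ) : EReal) := by
    intro ε hε
    obtain ⟨f, hf, hR⟩ := h ε hε
    have h0 : Tendsto (fun T : ℕ => (1 + ε) * a + f T / Real.log T) atTop (nhds ((1 + ε) * a)) := by
      have h1 : f =o[atTop] fun T : ℕ => Real.log (T : ℝ) :=
        hf.trans_isLittleO (Real.isLittleO_log_id_atTop.comp_tendsto hlog)
      simpa using h1.tendsto_div_nhds_zero.const_add ((1 + ε) * a)
    have h2 := ((continuous_coe_real_ereal.tendsto _).comp h0).limsup_eq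
    rw [← h2]
    refine limsup_le_limsup ?_
    filter_upwards [hlog.eventually_gt_atTop 0] with T hT
    have h3 : R T / Real.log T ≤ (1 + ε) * a + f T / Real.log T := by
      rw [div_le_iff₀ hT, add_mul, div_mul_cancel₀ _ hT.ne']
      exact hR T
    exact EReal.coe_le_coe_iff.2 h3
  have hlim : Tendsto (fun ε : ℝ => (((1 + ε) * a : ℝ) : EReal)) (nhdsWithin 0 (Set.Ioi 0))
      (nhds (a : EReal)) := by
    have h1 : Continuous fun ε : ℝ => (((1 + ε) * a : ℝ) : EReal) :=
      continuous_coe_real_ereal.comp (by fun_prop)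
    have h2 := h1.tendsto 0
    simp only [add_zero, one_mul] at h2
    exact h2.mono_left nhdsWithin_le_nhds
  exact ge_of_tendsto hlim (eventually_mem_nhdsWithin.mono fun ε h => hε ε h)

lemma cG_nonneg {V : Type*} [Fintype V] {G : SimpleGraph V} {ρ θ : V → ℝ} {dstar : V}
    (hstar : IsBest ρ θ dstar) : 0 ≤ cG G ρ θ dstar := by
  classical
  refine Finset.sum_nonneg fun d _ => mul_nonneg ?_ ENNReal.toReal_nonneg
  by_cases h : d = dstar
  · simp [h]
  · exact sub_nonneg.2 (hstar d h).le

end GORS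

theorem mainTheorem4 {M K : ℕ} (r : Fin K → ℝ) (hr_pos : ∀ k, 0 < r k) (hr_mono : StrictMono r)
    (G : SimpleGraph (Fin M × Fin K)) (θ : Fin M × Fin K → ℝ)
    (hcorr : GORS.Correlated θ) (huni : GORS.GraphUnimodal G (fun d => r d.2) θ)
    (dstar : Fin M × Fin K) (hstar : GORS.IsBest (fun d => r d.2) θ dstar)
    (c : ℝ) (hc : 0 < c) (p : ℕ) (hp : 2 ≤ p)
    {Ω : Type*} [MeasurableSpace Ω] (P : Measure Ω) [IsProbabilityMeasure P]
    (X : Fin M × Fin K → ℕ → Ω → ℝ) (hX : GORS.BernoulliOutcomes P θ X)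
    (dec lead : ℕ → Ω → Fin M × Fin K)
    (hdec : ∀ n, Measurable (dec n)) (hlead : ∀ n, Measurable (lead n))
    (hrun : ∀ ω, GORS.IsTrajectory G (fun d => r d.2) c p (fun d i => X d i ω)
      (fun n => dec n ω) (fun n => lead n ω)) :
    (∀ ε : ℝ, 0 < ε → ∃ f : ℕ → ℝ,
      f =O[atTop] (fun T : ℕ => Real.log (Real.log (T : ℝ))) ∧
      ∀ T : ℕ, GORS.regret P (fun d => r d.2) θ dstar dec T ≤
        (1 + ε) * GORS.cG G (fun d => r d.2) θ dstar * Real.log T + f T) ∧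
    limsup (fun T : ℕ =>
        ((GORS.regret P (fun d => r d.2) θ dstar dec T / Real.log T : ℝ) : EReal)) atTop ≤
      ((GORS.cG G (fun d => r d.2) θ dstar : ℝ) : EReal) := by
  have hbound : ∀ ε : ℝ, 0 < ε → ∃ f : ℕ → ℝ,
      f =O[atTop] (fun T : ℕ => Real.log (Real.log (T : ℝ))) ∧
      ∀ T : ℕ, GORS.regret P (fun d => r d.2) θ dstar dec T ≤
        (1 + ε) * GORS.cG G (fun d => r d.2) θ dstar * Real.log T + f T := by
    intro ε hε
    obtain ⟨C, hC⟩ := GORS.exists_regret_bound (fun d => hr_pos d.2) huni hstar hc hp hX hrun hdec hε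
    have hG := GORS.cG_nonneg (G := G) hstar
    -- The remainder `f` is the positive part of the excess of the regret over the logarithmic term,
    -- so the inequality holds for every `T`, small ones included.
    exact ⟨_, GORS.isBigO_loglog_of_le (by positivity) hC, fun T => by
      linarith [le_max_right 0 (GORS.regret P (fun d => r d.2) θ dstar dec T -
        (1 + ε) * GORS.cG G (fun d => r d.2) θ dstar * Real.log T)]⟩
  exact ⟨hbound, GORS.limsup_div_log_le hbound⟩
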